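/- **Setting.** Let $d\ge 0$, $I\ge 1$ be integers, $T>0$, let $\mathcal U,\mathcal V$ be nonempty compact subsets of finite-dimensional normed spaces, and let $b:[0,T]\times\mathbb R^d\times\mathcal U\times\mathcal V\to\mathbb R^d$, $\sigma:[0,T]\times\mathbb R^d\to\mathbb R^{d\times d}$, $\ell_i:[0,T]\times\mathbb R^d\times\mathcal U\times\mathcal V\to\mathbb R$ and $g_i:\mathbb R^d\to\mathbb R$ ($1\le i\le I$) satisfy: $b$ and $\ell_i$ are bounded, continuous, and Lipschitz in $(t,x)$ uniformly in $(u,v)$; $\sigma$ is bounded and Lipschitz, every $\sigma(t,x)$ is invertible, and $\sigma^{-T}:=(\sigma^T)^{-1}$ is bounded and Lipschitz; $g_i$ is bounded and Lipschitz. Let $\Delta=\{p\in[0,1]^I:\sum_i p_i=1\}$ be the closed simplex, and assume the Isaacs condition: for all $(t,x,z,p)\in[0,T]\times\mathbb R^d\times\mathbb R^d\times\Delta$, $$H(t,x,z,p):=\inf_{u\in\mathcal U}\sup_{v\in\mathcal V}\Big\{\langle b(t,x,u,v),z\rangle+\sum_{i}p_i\ell_i(t,x,u,v)\Big\}=\sup_{v\in\mathcal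 V}\inf_{u\in\mathcal U}\Big\{\langle b(t,x,u,v),z\rangle+\sum_{i}p_i\ell_i(t,x,u,v)\Big\}.$$ Consider the obstacle problem $$\min\Big\{\partial_tV+\tfrac12\mathrm{Tr}(\sigma\sigma^T D_x^2V)+H(t,x,D_xV,p),\ \lambda_{\min}\big(p,\tfrac{\partial^2V}{\partial p^2}\big)\Big\}=0,\qquad V(T,x,p)=\langle p,g(x)\rangle,\tag{1}$$ where $\lambda_{\min}(p,A)=\min\{\langle Az,z\rangle/|z|^2: z\in T_\Delta(p)\setminus\{0\}\}$, $T_\Delta(p)=\overline{\bigcup_{\delta>0}(\Delta-p)/\delta}$, and the minimum over the empty set (which occurs only for $I=1$) is $+\infty$. **Scheme.** Let $N\ge1$, $\tau=T/N$, $t_n=n\tau$, and let $\mathcal M$ be a finite face-to-face partition of $\Delta$ into $(I-1)$-simplices with largest diameter $h$ and set of vertices $\{p_1,\dots,p_M\}$. For data $Y=(Y^1,\dots,Y^M)$ put $\mathrm{Vex}[Y](p)=\min\{\sum_m\lambda_mY^m:\lambda_m\ge0,\ \sum_m\lambda_m=1,\ \sum_m\lambda_mp_m=p\}$. Let $\xi$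 be a random vector in $\{-1,1\}^d$ with independent components, each $\pm1$ with probability $1/2$. Set $V_N^m(x)=\langle p_m,g(x)\rangle$ and, for $n=N-1,\dots,0$, $$\bar X=x+\sigma(t_n,x)\xi\sqrt\tau,\quad Z^m_n(x)=\tfrac1\tau\mathbb E\big[V_{n+1}^m(\bar X)\,\sigma^{-T}(t_n,x)\xi\sqrt\tau\big],$$ $$Y_n^m(x)=\mathbb E\big[V^m_{n+1}(\bar X)\big]+\tau H(t_n,x,Z_n^m(x),p_m),\qquad V_n^m(x)=\mathrm{Vex}[Y_n^1(x),\dots,Y_n^M(x)](p_m).$$ Let $V_n^h(x,\cdot)=\mathrm{Vex}[V_n^1(x),\dots,V_n^M(x)]$ be the convex piecewise linear interpolant of the nodal values, and let $V_\tau^h(t,x,p)$ be the function on $[0,T]\times\mathbb R^d\times\Delta$ that interpolates the values $V_n^h(x,p)$ at $t_n$ linearly in $t$ on each $[t_n,t_{n+1}]$. An *accumulation point* of $\{V_\tau^h\}$ is a function $w$ on $[0,T]\times\mathbb R^d\times\Delta$ that is the limit, uniformly on every compact subset, of numerical solutions $V_{\tau_k}^{h_k}$ along some sequence of time steps $\tau_k\to0$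 and partitions of mesh size $h_k\to0$. **Supersolution.** A function $w$ on $[0,T]\times\mathbb R^d\times\Delta$ is a *viscosity supersolution* of (1) if it is lower semicontinuous, $w(T,x,p)\ge\langle p,g(x)\rangle$ for all $x\in\mathbb R^d$, $p\in\Delta$, and, whenever $(\bar t,\bar x,\bar p)\in[0,T)\times\mathbb R^d\times\Delta$, $\phi$ is a $C^\infty$ function on a neighbourhood of $(\bar t,\bar x,\bar p)$ in $\mathbb R\times\mathbb R^d\times\mathbb R^I$, and $w-\phi$ has at $(\bar t,\bar x,\bar p)$ a local minimum relative to $[0,T]\times\mathbb R^d\times\Delta$, one has at this point $$\min\Big\{\partial_t\phi+\tfrac12\mathrm{Tr}(\sigma\sigma^TD_x^2\phi)+H(\bar t,\bar x,D_x\phi,\bar p),\ \lambda_{\min}\big(\bar p,\tfrac{\partial^2\phi}{\partial p^2}\big)\Big\}\le0.$$ **Proposition.** Every accumulation point $w$ of $\{V_\tau^h\}$ is a viscosity supersolution of (1) on $[0,T]\times\mathbb R^d\times\Delta$. -/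

import Mathlib

open Set Filter Topology

namespace AsymGame

noncomputable section

/-- Euclidean space `ℝⁿ`. -/
abbrev E (n : ℕ) : Type := EuclideanSpace ℝ (Fin n)

/-! ### Data of the problem and standing assumptions -/

/-- The data: horizon `T`, control sets `U`, `V`, drift `b`, diffusion matrix `σ`, running costs
`ℓ i` and terminal payoffs `g i`. Only times in `[0, T]` and controls in `U`, `V` matter. -/
structure GameData (d I : ℕ) (EU EV : Type*) where
  T : ℝ
  U : Set EU
  V : Set EV
  b : ℝ → E d → EU → EV → E d
  σ : ℝ → E d → Matrix (Fin d) (Fin d) ℝ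
  ℓ : Fin I → ℝ → E d → EU → EV → ℝ
  g : Fin I → E d → ℝ

/-- The closed simplex of probability vectors in `ℝ^I`. -/
def simplex (I : ℕ) : Set (E I) := {p | (∀ i, 0 ≤ p i) ∧ ∑ i, p i = 1}

section Data

variable {d I : ℕ} {EU EV : Type*} (D : GameData d I EU EV)

/-- The expression `⟨b(t,x,u,v), z⟩ + ∑ᵢ pᵢ ℓᵢ(t,x,u,v)` under the inf-sup. -/
def GameData.payoffRate (t : ℝ) (x z : E d) (p : E I) (u : EU) (v : EV) : ℝ :=
  inner ℝ (D.b t x u v) z + ∑ i, p i * D.ℓ i t x u v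

/-- The Hamiltonian `H(t,x,z,p)`. -/
def GameData.H (t : ℝ) (x z : E d) (p : E I) : ℝ :=
  ⨅ u : D.U, ⨆ v : D.V, D.payoffRate t x z p u v

/-- The matrix `σ^{-T}(t,x)`. -/
def GameData.σInvT (t : ℝ) (x : E d) : Matrix (Fin d) (Fin d) ℝ := ((D.σ t x).transpose)⁻¹

/-- The standing assumptions. -/
structure GameData.Admissible [NormedAddCommGroup EU] [NormedAddCommGroup EV] : Prop where
  T_pos : 0 < D.T
  U_compact : IsCompact D.U
  U_nonempty : D.U.Nonempty
  V_compact : IsCompact D.V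
  V_nonempty : D.V.Nonempty
  -- the drift
  b_bdd : ∃ C : ℝ, ∀ t ∈ Icc 0 D.T, ∀ x, ∀ u ∈ D.U, ∀ v ∈ D.V, ‖D.b t x u v‖ ≤ C
  b_cont : ContinuousOn (fun q : ℝ × E d × EU × EV => D.b q.1 q.2.1 q.2.2.1 q.2.2.2)
    (Icc 0 D.T ×ˢ univ ×ˢ D.U ×ˢ D.V)
  b_lip : ∃ L : NNReal, ∀ u ∈ D.U, ∀ v ∈ D.V,
    LipschitzOnWith L (fun q : ℝ × E d => D.b q.1 q.2 u v) (Icc 0 D.T ×ˢ univ)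
  -- the diffusion matrix
  σ_bdd : ∃ C : ℝ, ∀ t ∈ Icc 0 D.T, ∀ x k l, |D.σ t x k l| ≤ C
  σ_lip : ∃ L : NNReal, ∀ k l,
    LipschitzOnWith L (fun q : ℝ × E d => D.σ q.1 q.2 k l) (Icc 0 D.T ×ˢ univ)
  σ_inv : ∀ t ∈ Icc 0 D.T, ∀ x, IsUnit (D.σ t x)
  σInvT_bdd : ∃ C : ℝ, ∀ t ∈ Icc 0 D.T, ∀ x k l, |D.σInvT t x k l| ≤ C
  σInvT_lip : ∃ L : NNReal, ∀ k l,
    LipschitzOnWith L (fun q : ℝ × E d => D.σInvT q.1 q.2 k l) (Icc 0 D.T ×ˢ univ)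
  -- the running costs
  ℓ_bdd : ∃ C : ℝ, ∀ i, ∀ t ∈ Icc 0 D.T, ∀ x, ∀ u ∈ D.U, ∀ v ∈ D.V, |D.ℓ i t x u v| ≤ C
  ℓ_cont : ∀ i, ContinuousOn (fun q : ℝ × E d × EU × EV => D.ℓ i q.1 q.2.1 q.2.2.1 q.2.2.2)
    (Icc 0 D.T ×ˢ univ ×ˢ D.U ×ˢ D.V)
  ℓ_lip : ∃ L : NNReal, ∀ i, ∀ u ∈ D.U, ∀ v ∈ D.V,
    LipschitzOnWith L (fun q : ℝ × E d => D.ℓ i q.1 q.2 u v) (Icc 0 D.T ×ˢ univ)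
  -- the terminal payoffs
  g_bdd : ∃ C : ℝ, ∀ i x, |D.g i x| ≤ C
  g_lip : ∃ L : NNReal, ∀ i, LipschitzWith L (D.g i)
  -- the Isaacs condition
  isaacs : ∀ t ∈ Icc 0 D.T, ∀ x z, ∀ p ∈ simplex I,
    (⨅ u : D.U, ⨆ v : D.V, D.payoffRate t x z p u v : ℝ) =
      (⨆ v : D.V, ⨅ u : D.U, D.payoffRate t x z p u v : ℝ)

/-- The pairing `⟨p, g(x)⟩`. -/
def GameData.terminal (x : E d) (p : E I) : ℝ := ∑ i, p i * D.g i x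

end Data

/-! ### Simplicial meshes of the simplex and the discrete lower convex envelope -/

/-- A (face-to-face) partition of the simplex into finitely many `(I-1)`-simplices; `complex` also
records the lower-dimensional faces of these simplices. -/
structure Mesh (I : ℕ) where
  complex : Geometry.SimplicialComplex ℝ (E I)
  finite_faces : complex.faces.Finite
  space_eq : complex.space = simplex I
  pure : ∀ s ∈ complex.faces, ∃ K ∈ complex.faces, s ⊆ K ∧ K.card = I

/-- The nodes of a mesh: all vertices of its simplices. -/
def Mesh.nodes {I : ℕ} (M : Mesh I) : Finset (E I) :=
  (show M.complex.vertices.Finite from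
    M.finite_faces.preimage (Finset.singleton_injective.injOn)).toFinset

/-- The mesh size: the largest diameter of a simplex. -/
def Mesh.size {I : ℕ} (M : Mesh I) : ℝ :=
  sSup ((fun K : Finset (E I) => Metric.diam (convexHull ℝ (K : Set (E I)))) '' M.complex.faces)

/-- The discrete lower convex envelope of the data `Y` on the nodes of `M`, at the point `p`:
the minimum of `∑ Y(q) λ_q` over all representations of `p` as a convex combination `∑ λ_q q` of
nodes. -/
def Mesh.vex {I : ℕ} (M : Mesh I) (Y : M.nodes → ℝ) (p : E I) : ℝ :=
  sInf {r | ∃ lam : M.nodes → ℝ, (∀ q, 0 ≤ lam q) ∧ ∑ q, lam q = 1 ∧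
    ∑ q, lam q • (q : E I) = p ∧ r = ∑ q, Y q * lam q}

/-! ### The numerical scheme -/

section Scheme

variable {d I : ℕ} {EU EV : Type*} (D : GameData d I EU EV)

/-- The value of the random walk step `ξ` at the sign pattern `ε`. -/
def signVec {d : ℕ} (ε : Fin d → ℤˣ) : E d := WithLp.toLp 2 (fun k => ((ε k : ℤ) : ℝ))

/-- `𝔼[f(ξ)]` for `ξ = (ξ¹, …, ξᵈ)` with i.i.d. components, `ℙ(ξᵏ = ±1) = 1/2`. -/
def walkExp {d : ℕ} {F : Type*} [AddCommGroup F] [Module ℝ F] (f : E d → F) : F :=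
  ((2 : ℝ) ^ d)⁻¹ • ∑ ε : Fin d → ℤˣ, f (signVec ε)

/-- The time step `τ = T / N`. -/
def GameData.τ (N : ℕ) : ℝ := D.T / N

/-- The grid time `t_n = n τ`. -/
def GameData.gridTime (N n : ℕ) : ℝ := n * D.τ N

/-- The Euler step `X̄ = x + σ(t_n, x) ξ √τ`. -/
def GameData.eulerStep (N n : ℕ) (x ξ : E d) : E d :=
  x + √(D.τ N) • WithLp.toLp 2 ((D.σ (D.gridTime N n) x).mulVec ξ.ofLp)

/-- The weight `σ^{-T}(t_n, x) ξ √τ`. -/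
def GameData.eulerWeight (N n : ℕ) (x ξ : E d) : E d :=
  √(D.τ N) • WithLp.toLp 2 ((D.σInvT (D.gridTime N n) x).mulVec ξ.ofLp)

/-- `Z = τ⁻¹ 𝔼[W(X̄) σ^{-T}(t_n, x) ξ √τ]`, for a function `W` at time `t_{n+1}`. -/
def GameData.stepZ (N n : ℕ) (W : E d → ℝ) (x : E d) : E d :=
  (D.τ N)⁻¹ • walkExp (fun ξ => W (D.eulerStep N n x ξ) • D.eulerWeight N n x ξ)

/-- `Y = 𝔼[W(X̄)] + τ H(t_n, x, Z, p)`, for a function `W` at time `t_{n+1}`. -/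
def GameData.stepY (N n : ℕ) (W : E d → ℝ) (x : E d) (p : E I) : ℝ :=
  walkExp (fun ξ => W (D.eulerStep N n x ξ)) +
    D.τ N * D.H (D.gridTime N n) x (D.stepZ N n W x) p

/-- The nodal values after `j` backward steps, that is at time index `N - j`. -/
def GameData.backward (N : ℕ) (M : Mesh I) : ℕ → E d → M.nodes → ℝ
  | 0, x, q => D.terminal x q
  | j + 1, x, q =>
      M.vex (fun q' => D.stepY N (N - (j + 1)) (fun y => GameData.backward N M j y q') x q') q

/-- The nodal values `V_n^m(x)`, for `0 ≤ n ≤ N`. -/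
def GameData.nodal (N : ℕ) (M : Mesh I) (n : ℕ) (x : E d) (q : M.nodes) : ℝ :=
  D.backward N M (N - n) x q

/-- The convex piecewise linear function `V_n^h(x, ·)` on the simplex with nodal values
`V_n^m(x)`: the lower convex envelope of these values. -/
def GameData.Vh (N : ℕ) (M : Mesh I) (n : ℕ) (x : E d) (p : E I) : ℝ :=
  M.vex (D.nodal N M n x) p

/-- The numerical solution `V_τ^h(t, x, p)`, with `τ = T / N`: the piecewise linear interpolation
in time. For `t ∈ [0, T]` the index `n` satisfies `n < N` and `t ∈ [t_n, t_{n+1}]`. -/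
def GameData.Vτh (N : ℕ) (M : Mesh I) (P : ℝ × E d × E I) : ℝ :=
  let n := min ⌊P.1 / D.τ N⌋₊ (N - 1)
  D.Vh N M n P.2.1 P.2.2 * ((D.gridTime N (n + 1) - P.1) / D.τ N) +
    D.Vh N M (n + 1) P.2.1 P.2.2 * ((P.1 - D.gridTime N n) / D.τ N)

/-- The domain `[0,T] × ℝᵈ × Δ`, with the closed simplex `Δ`. -/
def GameData.domain : Set (ℝ × E d × E I) := Icc 0 D.T ×ˢ univ ×ˢ simplex I

/-- `w` is an accumulation point of the numerical solutions as `τ → 0` and `h → 0`: a limit,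
uniformly on compact subsets of the domain, of numerical solutions along some sequence of time
steps and meshes whose sizes tend to zero. -/
def GameData.IsAccumulationPoint (w : ℝ × E d × E I → ℝ) : Prop :=
  ∃ (N : ℕ → ℕ) (M : ℕ → Mesh I), (∀ k, 0 < N k) ∧
    Tendsto (fun k => D.τ (N k)) atTop (𝓝 0) ∧
    Tendsto (fun k => (M k).size) atTop (𝓝 0) ∧
    ∀ K : Set (ℝ × E d × E I), IsCompact K → K ⊆ D.domain →
      TendstoUniformlyOn (fun k => D.Vτh (N k) (M k)) w atTop K

end Scheme

/-! ### Viscosity supersolutions -/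

/-- The Hessian matrix of `f : ℝⁿ → ℝ` at `x`. -/
def hessian {n : ℕ} (f : E n → ℝ) (x : E n) : Matrix (Fin n) (Fin n) ℝ :=
  Matrix.of fun i j =>
    fderiv ℝ (fun y => fderiv ℝ f y (EuclideanSpace.single j 1)) x (EuclideanSpace.single i 1)

/-- The tangent cone to the simplex at `p`: the closure of `⋃_{δ > 0} (Δ - p) / δ`. -/
def tangentCone {I : ℕ} (p : E I) : Set (E I) :=
  closure {z | ∃ δ : ℝ, 0 < δ ∧ ∃ q ∈ simplex I, z = δ⁻¹ • (q - p)}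

/-- `λ_min(p, A)`: the minimum of `⟨Az, z⟩ / |z|²` over the nonzero vectors of the tangent cone,
which is `+∞` if there are none (that is, if the simplex is a point). -/
def lambdaMin {I : ℕ} (p : E I) (A : Matrix (Fin I) (Fin I) ℝ) : EReal :=
  ⨅ z ∈ tangentCone p \ {0}, ((dotProduct (A.mulVec z.ofLp) z.ofLp / ‖z‖ ^ 2 : ℝ) : EReal)

section Viscosity

variable {d I : ℕ} {EU EV : Type*} (D : GameData d I EU EV)

/-- The expression `∂ₜφ + ½ Tr(σσᵀ D²ₓφ) + H(t, x, Dₓφ, p)` at the point `(t, x, p)`. -/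
def GameData.hjb (φ : ℝ × E d × E I → ℝ) (t : ℝ) (x : E d) (p : E I) : ℝ :=
  deriv (fun s => φ (s, x, p)) t +
    1 / 2 * (D.σ t x * (D.σ t x).transpose * hessian (fun y => φ (t, y, p)) x).trace +
    D.H t x (gradient (fun y => φ (t, y, p)) x) p

/-- Viscosity supersolutions of the obstacle problem
`min {∂ₜV + ½ Tr(σσᵀ D²ₓV) + H(t, x, DₓV, p), λ_min(p, ∂²V/∂p²)} = 0`, `V(T, x, p) = ⟨p, g(x)⟩`
on `[0,T] × ℝᵈ × Δ`. Test functions are smooth in a neighbourhood of the contact point in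
`ℝ × ℝᵈ × ℝ^I`; at the terminal time the differential inequality is replaced by the terminal
inequality. -/
structure GameData.IsViscositySupersolution (w : ℝ × E d × E I → ℝ) : Prop where
  lsc : LowerSemicontinuousOn w D.domain
  terminal : ∀ x, ∀ p ∈ simplex I, D.terminal x p ≤ w (D.T, x, p)
  interior : ∀ (φ : ℝ × E d × E I → ℝ) (t : ℝ) (x : E d) (p : E I),
    t ∈ Ico 0 D.T → p ∈ simplex I →
    (∃ O ∈ 𝓝 (t, x, p), ContDiffOn ℝ (⊤ : ℕ∞) φ O) →
    IsLocalMinOn (fun P => w P - φ P) D.domain (t, x, p) →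
    min (D.hjb φ t x p : EReal) (lambdaMin p (hessian (fun q => φ (t, x, q)) p)) ≤ 0

end Viscosity

end

end AsymGame

/-!
Let the accumulation point `w` be touched from below by a smooth `φ` at `P₀ = (t, x, p)`, and
suppose that both `λ_min(p, ∂²φ/∂p²)` and the differential expression in `φ` are positive. The
first step replaces `φ` by a quadratic polynomial. By Taylor's formula the second-order expansion
of `φ`, minus a small multiple of the squared distance, still touches `w` from below, now strictly.
Only the values of the `pp`-part of its Hessian on the vectors `q - p` with `q ∈ Δ` matter for
this, and these lie in the tangent cone, where the form is at least `c |q - p|²` with `c > 0`.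
Hence the `pp`-block may be replaced by `c` times the identity, which gives a quadratic polynomial
`Q` that is strictly convex in `p` in *all* directions
(`GameData.IsAccumulationPoint.min_hjb_lambdaMin_nonpos`). This matters because the contact points
of the numerical solutions need not lie at `p`, and their tangent cones may be larger.

The strict contact of `w` and `Q` is inherited by the numerical solutions, restricted to grid
times: the minima of their differences with `Q` near `P₀` are attained, since the numerical
solutions are lower semicontinuous, and converge to `P₀`
(`GameData.Admissible.exists_discrete_contact`). At such a discrete contact point the lower convex
envelope in `p` is touched from below by a strictly convex function. If an optimal representation
of the contact point charged another node, then the average of the envelope over two points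
symmetric about the contact point would not exceed its value there, against strict convexity. So
the contact point is itself a node, and the envelope equals the datum `Y` there
(`Mesh.eq_node_of_touching`): the convexification is inactive. Note that the representation may
charge distant nodes, so this argument is not local in `p`.

What remains is the classical argument for monotone schemes: for small time steps the step `Y` is
monotone in the function it is applied to (`GameData.stepY_mono`), because the Hamiltonian is
Lipschitz in the gradient and the weights `σ^{-T} ξ √τ` are small. So the numerical solution may be
replaced by `Q` plus a constant. The scheme is exact on quadratic polynomials
(`GameData.stepY_of_quadratic`), whence the discrete inequality
`GameData.Admissible.discrete_inequality`, and the limit along the contact points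
(`GameData.IsAccumulationPoint.quadratic_inequality`) contradicts the positivity of the
differential expression, if the perturbation of `φ` is small enough.

Lower semicontinuity of `w` passes to the limit from the envelopes
(`Mesh.lowerSemicontinuousOn_vex`), and the terminal condition holds because the envelope of linear
data is linear (`Mesh.vex_linear`).
-/

namespace AsymGame

/-! ### Expectations over the symmetric random walk step -/

section Walk

variable {d : ℕ} {F G : Type*} [AddCommGroup F] [Module ℝ F] [AddCommGroup G] [Module ℝ G]

@[simp] lemma signVec_apply (ε : Fin d → ℤˣ) (k : Fin d) : signVec ε k = ((ε k : ℤ) : ℝ) := rfl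

lemma signVec_neg (ε : Fin d → ℤˣ) : signVec (-ε) = -signVec ε := by
  ext k; simp

lemma walkExp_const (c : F) : walkExp (fun _ : E d => c) = c := by
  simp only [walkExp, Finset.sum_const, Finset.card_univ, Fintype.card_pi, Fintype.card_units_int,
    Finset.prod_const, Fintype.card_fin]
  rw [← Nat.cast_smul_eq_nsmul ℝ, smul_smul]
  simp

lemma walkExp_add (f g : E d → F) :
    walkExp (fun ξ => f ξ + g ξ) = walkExp f + walkExp g := by
  simp [walkExp, Finset.sum_add_distrib]

lemma walkExp_map (A : F →ₗ[ℝ] G) (f : E d → F) : walkExp (fun ξ => A (f ξ)) = A (walkExp f) := by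
  simp [walkExp]

lemma walkExp_smul (c : ℝ) (f : E d → F) : walkExp (fun ξ => c • f ξ) = c • walkExp f :=
  walkExp_map (LinearMap.lsmul ℝ F c) f

lemma walkExp_sum {ι : Type*} (s : Finset ι) (f : ι → E d → F) :
    walkExp (fun ξ => ∑ i ∈ s, f i ξ) = ∑ i ∈ s, walkExp (f i) := by
  simp only [walkExp, ← Finset.smul_sum]
  rw [Finset.sum_comm]

lemma walkExp_odd {f : E d → F} (hf : ∀ ξ, f (-ξ) = -f ξ) : walkExp f = 0 := by
  have h : ∑ ε : Fin d → ℤˣ, f (signVec ε) = -∑ ε : Fin d → ℤˣ, f (signVec ε) := by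
    rw [← Finset.sum_neg_distrib]
    exact Fintype.sum_equiv (Equiv.neg _) _ _ fun ε => by simp [signVec_neg, hf]
  have h2 : (2 : ℝ) • ∑ ε : Fin d → ℤˣ, f (signVec ε) = 0 := by
    rw [two_smul]
    exact add_eq_zero_iff_eq_neg.2 h
  rw [walkExp, (smul_eq_zero.1 h2).resolve_left two_ne_zero, smul_zero]

lemma walkExp_mono {f g : E d → ℝ} (h : ∀ ε : Fin d → ℤˣ, f (signVec ε) ≤ g (signVec ε)) :
    walkExp f ≤ walkExp g := by
  simp only [walkExp, smul_eq_mul]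
  exact mul_le_mul_of_nonneg_left (Finset.sum_le_sum fun ε _ => h ε) (by positivity)

lemma eq_sum_smul_single (y : E d) : y = ∑ i, y i • EuclideanSpace.single i (1 : ℝ) := by
  ext k; simp [Finset.sum_apply, Pi.single_apply]

/-- The components of the random walk step are uncorrelated with unit variance. -/
lemma walkExp_apply_mul_apply (k l : Fin d) :
    walkExp (fun ξ : E d => ξ k * ξ l) = if k = l then (1 : ℝ) else 0 := by
  split_ifs with h
  · subst h
    rw [← walkExp_const (d := d) (1 : ℝ)]
    simp only [walkExp, signVec_apply]
    congr 1
    refine Finset.sum_congr rfl fun ε _ => ?_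
    rcases Int.units_eq_one_or (ε k) with h | h <;> simp [h]
  · have : ∑ ε : Fin d → ℤˣ, signVec ε k * signVec ε l =
        -∑ ε : Fin d → ℤˣ, signVec ε k * signVec ε l := by
      rw [← Finset.sum_neg_distrib]
      -- flip the sign of the `k`-th component
      refine Fintype.sum_equiv (Equiv.mulLeft (Pi.mulSingle k (-1 : ℤˣ))) _ _ fun ε => ?_
      simp [Pi.mulSingle_eq_of_ne (Ne.symm h)]
    rw [walkExp, self_eq_neg.1 this, smul_zero]

lemma norm_walkExp_le {F : Type*} [NormedAddCommGroup F] [NormedSpace ℝ F] (f : E d → F) :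
    ‖walkExp f‖ ≤ walkExp (fun ξ => ‖f ξ‖) := by
  rw [walkExp, norm_smul, walkExp, smul_eq_mul, Real.norm_of_nonneg (by positivity)]
  exact mul_le_mul_of_nonneg_left (norm_sum_le _ _) (by positivity)

lemma continuous_walkExp {X F : Type*} [TopologicalSpace X] [NormedAddCommGroup F]
    [NormedSpace ℝ F] {f : X → E d → F}
    (hf : ∀ ε : Fin d → ℤˣ, Continuous fun x => f x (signVec ε)) :
    Continuous fun x => walkExp (f x) := by
  unfold walkExp
  exact (continuous_finsetSum _ fun ε _ => hf ε).const_smul _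

end Walk

/-! ### The Hamiltonian -/

section Hamiltonian

variable {d I : ℕ} {EU EV : Type*} [NormedAddCommGroup EU] [NormedAddCommGroup EV]
  {D : GameData d I EU EV}

lemma GameData.Admissible.exists_payoffRate_bound (hD : D.Admissible) {t : ℝ} (ht : t ∈ Icc 0 D.T)
    (x z : E d) (p : E I) :
    ∃ C, ∀ u ∈ D.U, ∀ v ∈ D.V, |D.payoffRate t x z p u v| ≤ C := by
  obtain ⟨Cb, hb⟩ := hD.b_bdd
  obtain ⟨Cl, hl⟩ := hD.ℓ_bdd
  refine ⟨Cb * ‖z‖ + ∑ i, |p i| * Cl, fun u hu v hv => ?_⟩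
  refine (abs_add_le _ _).trans (add_le_add ?_ ?_)
  · exact (abs_real_inner_le_norm _ _).trans
      (mul_le_mul_of_nonneg_right (hb t ht x u hu v hv) (norm_nonneg _))
  · refine (Finset.abs_sum_le_sum_abs _ _).trans (Finset.sum_le_sum fun i _ => ?_)
    rw [abs_mul]
    exact mul_le_mul_of_nonneg_left (hl i t ht x u hu v hv) (abs_nonneg _)

/-- The inf-sup is monotone and commutes with constants. The boundedness of the payoff rates keeps
the infima and suprema from being junk values. -/
lemma GameData.Admissible.H_le_H_add (hD : D.Admissible) {t t' : ℝ} (ht : t ∈ Icc 0 D.T)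
    (ht' : t' ∈ Icc 0 D.T) {x x' z z' : E d} {p p' : E I} {η : ℝ}
    (h : ∀ u ∈ D.U, ∀ v ∈ D.V, D.payoffRate t x z p u v ≤ D.payoffRate t' x' z' p' u v + η) :
    D.H t x z p ≤ D.H t' x' z' p' + η := by
  have := hD.U_nonempty.to_subtype
  have := hD.V_nonempty.to_subtype
  obtain ⟨C, hC⟩ := hD.exists_payoffRate_bound ht x z p
  obtain ⟨C', hC'⟩ := hD.exists_payoffRate_bound ht' x' z' p'
  obtain ⟨v₀⟩ := ‹Nonempty D.V›
  have hbdd (u : D.U) : BddAbove (range fun v : D.V => D.payoffRate t x z p u v) :=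
    ⟨C, by rintro _ ⟨v, rfl⟩; exact (abs_le.1 (hC u u.2 v v.2)).2⟩
  have hbdd' (u : D.U) : BddAbove (range fun v : D.V => D.payoffRate t' x' z' p' u v) :=
    ⟨C', by rintro _ ⟨v, rfl⟩; exact (abs_le.1 (hC' u u.2 v v.2)).2⟩
  have hbelow : BddBelow (range fun u : D.U => ⨆ v : D.V, D.payoffRate t x z p u v) :=
    ⟨-C, by
      rintro _ ⟨u, rfl⟩
      exact (abs_le.1 (hC u u.2 v₀ v₀.2)).1.trans (le_ciSup (hbdd u) v₀)⟩
  rw [← sub_le_iff_le_add]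
  refine le_ciInf fun u => ?_
  rw [sub_le_iff_le_add]
  refine (ciInf_le hbelow u).trans (ciSup_le fun v => ?_)
  exact (h u u.2 v v.2).trans (add_le_add_left (le_ciSup (hbdd' u) v) η)

/-- The Hamiltonian is Lipschitz in the gradient variable, with a bound of the drift as constant. -/
lemma GameData.Admissible.exists_H_lipschitz (hD : D.Admissible) :
    ∃ B, 0 ≤ B ∧ ∀ t ∈ Icc 0 D.T, ∀ x z z' p, D.H t x z p ≤ D.H t x z' p + B * ‖z - z'‖ := by
  obtain ⟨B, hB⟩ := hD.b_bdd
  refine ⟨max B 0, le_max_right _ _, fun t ht x z z' p => hD.H_le_H_add ht ht fun u hu v hv => ?_⟩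
  have h : inner ℝ (D.b t x u v) (z - z') ≤ max B 0 * ‖z - z'‖ :=
    (real_inner_le_norm _ _).trans (mul_le_mul_of_nonneg_right
      ((hB t ht x u hu v hv).trans (le_max_left _ _)) (norm_nonneg _))
  rw [inner_sub_right] at h
  simp only [GameData.payoffRate]
  linarith

lemma GameData.Admissible.continuousOn_H (hD : D.Admissible) :
    ContinuousOn (fun q : ℝ × E d × E d × E I => D.H q.1 q.2.1 q.2.2.1 q.2.2.2)
      (Icc 0 D.T ×ˢ univ) := by
  obtain ⟨B, hB⟩ := hD.b_bdd
  obtain ⟨Lb, hLb⟩ := hD.b_lip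
  obtain ⟨C, hC⟩ := hD.ℓ_bdd
  obtain ⟨Ll, hLl⟩ := hD.ℓ_lip
  -- the payoff rates are continuous uniformly in the controls
  have key (t t' : ℝ) (ht : t ∈ Icc 0 D.T) (ht' : t' ∈ Icc 0 D.T) (x x' z z' : E d) (p p' : E I) :
      ∀ u ∈ D.U, ∀ v ∈ D.V, |D.payoffRate t x z p u v - D.payoffRate t' x' z' p' u v| ≤
        B * ‖z - z'‖ + Lb * dist (t, x) (t', x') * ‖z'‖ +
          ∑ i, (|p i - p' i| * C + |p' i| * (Ll * dist (t, x) (t', x'))) := by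
    intro u hu v hv
    have e : D.payoffRate t x z p u v - D.payoffRate t' x' z' p' u v =
        inner ℝ (D.b t x u v) (z - z') + inner ℝ (D.b t x u v - D.b t' x' u v) z' +
          ∑ i, ((p i - p' i) * D.ℓ i t x u v + p' i * (D.ℓ i t x u v - D.ℓ i t' x' u v)) := by
      simp only [GameData.payoffRate, inner_sub_left, inner_sub_right]
      rw [show ∀ a b c d : ℝ, a + b - (c + d) = (a - c) + (b - d) by intros; ring,
        ← Finset.sum_sub_distrib]
      congr 1
      · ring
      · exact Finset.sum_congr rfl fun i _ => by ring
    rw [e]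
    refine (abs_add_le _ _).trans (add_le_add ((abs_add_le _ _).trans (add_le_add ?_ ?_)) ?_)
    · exact (abs_real_inner_le_norm _ _).trans
        (mul_le_mul_of_nonneg_right (hB t ht x u hu v hv) (norm_nonneg _))
    · refine (abs_real_inner_le_norm _ _).trans (mul_le_mul_of_nonneg_right ?_ (norm_nonneg _))
      rw [← dist_eq_norm]
      exact (hLb u hu v hv).dist_le_mul (t, x) ⟨ht, mem_univ _⟩ (t', x') ⟨ht', mem_univ _⟩
    · refine (Finset.abs_sum_le_sum_abs _ _).trans (Finset.sum_le_sum fun i _ => ?_)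
      refine (abs_add_le _ _).trans (add_le_add ?_ ?_)
      · rw [abs_mul]
        exact mul_le_mul_of_nonneg_left (hC i t ht x u hu v hv) (abs_nonneg _)
      · rw [abs_mul, ← Real.dist_eq (D.ℓ i t x u v)]
        exact mul_le_mul_of_nonneg_left
          ((hLl i u hu v hv).dist_le_mul (t, x) ⟨ht, mem_univ _⟩ (t', x') ⟨ht', mem_univ _⟩)
          (abs_nonneg _)
  rintro ⟨t', x', z', p'⟩ ⟨ht', -⟩
  rw [ContinuousWithinAt, tendsto_iff_dist_tendsto_zero]
  have hcont : Continuous fun q : ℝ × E d × E d × E I =>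
      B * ‖q.2.2.1 - z'‖ + Lb * dist (q.1, q.2.1) (t', x') * ‖z'‖ +
        ∑ i, (|q.2.2.2 i - p' i| * C + |p' i| * (Ll * dist (q.1, q.2.1) (t', x'))) := by
    fun_prop
  have hlim := (hcont.tendsto (t', x', z', p')).mono_left
    (nhdsWithin_le_nhds (s := Icc 0 D.T ×ˢ univ))
  simp only [sub_self, norm_zero, mul_zero, dist_self, abs_zero, zero_mul, add_zero,
    Finset.sum_const_zero] at hlim
  refine squeeze_zero' (Eventually.of_forall fun _ => dist_nonneg) ?_ hlim
  filter_upwards [self_mem_nhdsWithin] with q hq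
  rw [Real.dist_eq, abs_le]
  have hkey := key q.1 t' hq.1 ht' q.2.1 x' q.2.2.1 z' q.2.2.2 p'
  have h1 := hD.H_le_H_add hq.1 ht' fun u hu v hv =>
    sub_le_iff_le_add'.1 (abs_le.1 (hkey u hu v hv)).2
  have h2 := hD.H_le_H_add ht' hq.1 fun u hu v hv =>
    neg_le_sub_iff_le_add.1 (abs_le.1 (hkey u hu v hv)).1
  constructor <;> linarith

end Hamiltonian

/-! ### The discrete lower convex envelope -/

section Vex

variable {I : ℕ}

lemma isCompact_simplex : IsCompact (simplex I) := by
  have h : simplex I = WithLp.toLp 2 '' stdSimplex ℝ (Fin I) := by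
    ext p
    constructor
    · exact fun hp => ⟨p.ofLp, hp, rfl⟩
    · rintro ⟨q, hq, rfl⟩
      exact hq
  rw [h]
  exact (isCompact_stdSimplex ℝ (Fin I)).image (PiLp.continuous_toLp 2 _)

lemma convex_simplex : Convex ℝ (simplex I) := by
  intro p hp q hq a b ha hb hab
  refine ⟨fun i => ?_, ?_⟩
  · simpa using add_nonneg (mul_nonneg ha (hp.1 i)) (mul_nonneg hb (hq.1 i))
  · simp [Finset.sum_add_distrib, ← Finset.mul_sum, hp.2, hq.2, hab]

namespace Mesh

variable (M : Mesh I)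

lemma mem_nodes {q : E I} : q ∈ M.nodes ↔ {q} ∈ M.complex.faces := by
  simp [nodes, Geometry.SimplicialComplex.mem_vertices]

lemma mem_simplex (q : M.nodes) : (q : E I) ∈ simplex I := by
  rw [← M.space_eq]
  exact M.complex.vertices_subset_space (M.mem_nodes.1 q.2)

/-- `lam` is a system of weights representing `p` as a convex combination of the nodes. -/
def IsRep (p : E I) (lam : M.nodes → ℝ) : Prop :=
  lam ∈ stdSimplex ℝ M.nodes ∧ ∑ q, lam q • (q : E I) = p

variable {M}

lemma IsRep.mem_simplex {p : E I} {lam : M.nodes → ℝ} (h : M.IsRep p lam) : p ∈ simplex I := by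
  rw [← h.2]
  exact convex_simplex.sum_mem (fun q _ => h.1.1 q) h.1.2 fun q _ => M.mem_simplex q

variable (M) in
lemma exists_isRep {p : E I} (hp : p ∈ simplex I) : ∃ lam, M.IsRep p lam := by
  rw [← M.space_eq, Geometry.SimplicialComplex.mem_space_iff] at hp
  obtain ⟨s, hs, hps⟩ := hp
  have hsub : (s : Set (E I)) ⊆ (M.nodes : Set (E I)) := fun q hq =>
    M.mem_nodes.2 (M.complex.down_closed hs (Finset.singleton_subset_iff.2 hq) (by simp))
  obtain ⟨w, hw0, hw1, hwp⟩ := Finset.mem_convexHull'.1 (convexHull_mono hsub hps)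
  refine ⟨fun q => w q, ⟨fun q => hw0 q q.2, ?_⟩, ?_⟩
  · rw [← hw1, ← Finset.sum_coe_sort M.nodes]
  · rw [← hwp, ← Finset.sum_coe_sort M.nodes]

lemma isRep_single (q : M.nodes) : M.IsRep q (Pi.single q 1) :=
  ⟨single_mem_stdSimplex ℝ q, by simp [Pi.single_apply]⟩

lemma isCompact_isRep (p : E I) : IsCompact {lam | M.IsRep p lam} := by
  have : IsClosed {lam : M.nodes → ℝ | ∑ q, lam q • (q : E I) = p} :=
    isClosed_eq (by fun_prop) continuous_const
  exact (isCompact_stdSimplex ℝ M.nodes).inter_right this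

lemma vex_eq (Y : M.nodes → ℝ) (p : E I) :
    M.vex Y p = sInf ((fun lam => ∑ q, Y q * lam q) '' {lam | M.IsRep p lam}) := by
  rw [vex]
  congr 1
  ext r
  constructor
  · rintro ⟨lam, h0, h1, h2, rfl⟩
    exact ⟨lam, ⟨⟨h0, h1⟩, h2⟩, rfl⟩
  · rintro ⟨lam, ⟨⟨h0, h1⟩, h2⟩, rfl⟩
    exact ⟨lam, h0, h1, h2, rfl⟩

lemma IsRep.vex_le {p : E I} {lam : M.nodes → ℝ} (h : M.IsRep p lam) (Y : M.nodes → ℝ) :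
    M.vex Y p ≤ ∑ q, Y q * lam q := by
  rw [vex_eq]
  exact csInf_le ((isCompact_isRep p).image (by fun_prop)).bddBelow ⟨lam, h, rfl⟩

lemma exists_isRep_vex_eq (Y : M.nodes → ℝ) {p : E I} (hp : p ∈ simplex I) :
    ∃ lam, M.IsRep p lam ∧ M.vex Y p = ∑ q, Y q * lam q := by
  obtain ⟨lam₀, h₀⟩ := M.exists_isRep hp
  have hc : IsCompact ((fun lam : M.nodes → ℝ => ∑ q, Y q * lam q) '' {lam | M.IsRep p lam}) :=
    (isCompact_isRep p).image (by fun_prop)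
  obtain ⟨lam, h, e⟩ := hc.sInf_mem ⟨_, lam₀, h₀, rfl⟩
  exact ⟨lam, h, by rw [vex_eq, ← e]⟩

lemma vex_node_le (Y : M.nodes → ℝ) (q : M.nodes) : M.vex Y q ≤ Y q := by
  simpa [Pi.single_apply] using (isRep_single q).vex_le Y

/-- The envelope of the data `Y` lies above that of `Y'` as soon as `Y ≥ vex Y'` at the nodes. -/
lemma vex_le_vex {Y Y' : M.nodes → ℝ} (h : ∀ q : M.nodes, M.vex Y' q ≤ Y q) {p : E I}
    (hp : p ∈ simplex I) :
    M.vex Y' p ≤ M.vex Y p := by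
  obtain ⟨lam, hlam, e⟩ := exists_isRep_vex_eq Y hp
  choose mu hmu hmue using fun q : M.nodes => exists_isRep_vex_eq Y' (M.mem_simplex q)
  -- substitute optimal representations of the nodes into an optimal representation of `p`
  have hrep : M.IsRep p fun r => ∑ q, lam q * mu q r := by
    refine ⟨⟨fun r => Finset.sum_nonneg fun q _ => mul_nonneg (hlam.1.1 q) ((hmu q).1.1 r), ?_⟩, ?_⟩
    · rw [Finset.sum_comm]
      simp_rw [← Finset.mul_sum, (hmu _).1.2, mul_one]
      exact hlam.1.2
    · simp_rw [Finset.sum_smul]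
      rw [Finset.sum_comm, ← hlam.2]
      refine Finset.sum_congr rfl fun q _ => ?_
      simp_rw [mul_smul]
      rw [← Finset.smul_sum, (hmu q).2]
  refine (hrep.vex_le Y').trans ?_
  rw [e]
  have : ∑ r, Y' r * ∑ q, lam q * mu q r = ∑ q, lam q * M.vex Y' q := by
    simp_rw [hmue, Finset.mul_sum]
    rw [Finset.sum_comm]
    exact Finset.sum_congr rfl fun q _ => Finset.sum_congr rfl fun r _ => by ring
  rw [this]
  exact Finset.sum_le_sum fun q _ => by
    rw [mul_comm]; exact mul_le_mul_of_nonneg_right (h q) (hlam.1.1 q)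

/-- The envelope of the nodal values of an envelope is the same envelope. -/
lemma vex_vex (Y : M.nodes → ℝ) {p : E I} (hp : p ∈ simplex I) :
    M.vex (fun q => M.vex Y q) p = M.vex Y p :=
  le_antisymm (vex_le_vex (fun q => (vex_node_le _ q).trans (vex_node_le Y q)) hp)
    (vex_le_vex (fun _ => le_rfl) hp)

lemma vex_linear (c : Fin I → ℝ) {p : E I} (hp : p ∈ simplex I) :
    M.vex (fun q => ∑ i, (q : E I) i * c i) p = ∑ i, p i * c i := by
  obtain ⟨lam, hlam, e⟩ := exists_isRep_vex_eq (fun q : M.nodes => ∑ i, (q : E I) i * c i) hp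
  rw [e, ← hlam.2]
  simp only [WithLp.ofLp_sum, WithLp.ofLp_smul, Finset.sum_apply, Pi.smul_apply, smul_eq_mul,
    Finset.sum_mul]
  rw [Finset.sum_comm]
  exact Finset.sum_congr rfl fun i _ => Finset.sum_congr rfl fun q _ => by ring

lemma vex_le_vex_add {Y Y' : M.nodes → ℝ} {η : ℝ} (h : ∀ q, Y q ≤ Y' q + η) {p : E I}
    (hp : p ∈ simplex I) : M.vex Y p ≤ M.vex Y' p + η := by
  obtain ⟨lam, hlam, e⟩ := exists_isRep_vex_eq Y' hp
  rw [e]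
  refine (hlam.vex_le Y).trans ?_
  have : ∑ q, Y' q * lam q + η = ∑ q, (Y' q + η) * lam q := by
    rw [← mul_one η, ← hlam.1.2]
    simp only [add_mul, Finset.sum_add_distrib, ← Finset.mul_sum, hlam.1.2, mul_one]
  rw [this]
  exact Finset.sum_le_sum fun q _ => mul_le_mul_of_nonneg_right (h q) (hlam.1.1 q)

lemma continuous_vex {X : Type*} [TopologicalSpace X] {Y : X → M.nodes → ℝ} (hY : Continuous Y)
    {p : E I} (hp : p ∈ simplex I) : Continuous fun x => M.vex (Y x) p := by
  have h (Y Y' : M.nodes → ℝ) : M.vex Y p ≤ M.vex Y' p + dist Y Y' := vex_le_vex_add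
    (fun q => sub_le_iff_le_add'.1 ((le_abs_self _).trans (dist_le_pi_dist Y Y' q))) hp
  exact (LipschitzWith.of_le_add h).continuous.comp hY

/-- The envelope is jointly lower semicontinuous in the data and the point. -/
lemma lowerSemicontinuousOn_vex {X : Type*} [TopologicalSpace X] {Y : X → M.nodes → ℝ}
    (hY : Continuous Y) :
    LowerSemicontinuousOn (fun P : X × E I => M.vex (Y P.1) P.2) (univ ×ˢ simplex I) := by
  rw [lowerSemicontinuousOn_iff_preimage_Iic]
  intro a
  have := isCompact_iff_compactSpace.1 (isCompact_stdSimplex ℝ M.nodes)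
  -- sublevel sets are projections of closed sets along the compact set of weights
  let Z : Set ((X × E I) × stdSimplex ℝ M.nodes) :=
    {z | ∑ q, (z.2 : M.nodes → ℝ) q • (q : E I) = z.1.2 ∧
      ∑ q, Y z.1.1 q * (z.2 : M.nodes → ℝ) q ≤ a}
  have hZ : IsClosed Z := by
    refine IsClosed.and (isClosed_eq ?_ (by fun_prop)) (isClosed_le ?_ continuous_const)
    · exact continuous_finsetSum _ fun q _ =>
        ((continuous_apply q).comp (continuous_subtype_val.comp continuous_snd)).smul
          continuous_const
    · exact continuous_finsetSum _ fun q _ =>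
        ((continuous_apply q).comp (hY.comp (continuous_fst.comp continuous_fst))).mul
          ((continuous_apply q).comp (continuous_subtype_val.comp continuous_snd))
  refine ⟨Prod.fst '' Z, isClosedMap_fst_of_compactSpace _ hZ, ?_⟩
  ext ⟨x, p⟩
  simp only [mem_inter_iff, mem_prod, mem_univ, true_and, mem_preimage, mem_Iic, mem_image,
    Prod.exists, exists_and_right, exists_eq_right]
  refine and_congr_right fun hp => ⟨fun h => ?_, ?_⟩
  · obtain ⟨lam, hlam, e⟩ := exists_isRep_vex_eq (Y x) hp
    exact ⟨⟨lam, hlam.1⟩, hlam.2, e ▸ h⟩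
  · rintro ⟨lam, h1, h2⟩
    exact (IsRep.vex_le ⟨lam.2, h1⟩ (Y x)).trans h2

/-- Where the envelope is touched from below by a strictly midpoint convex function, only the
trivial representation is optimal: the contact point is a node, and the data are not lowered there.
If an optimal representation charged another node `q`, shifting a small weight `s` to or from `q`
would give two points symmetric about `p` at which the values of the envelope add up to at most
twice its value at `p`. -/
lemma eq_node_of_touching {Y : M.nodes → ℝ} {p : E I} (hp : p ∈ simplex I) {G : E I → ℝ}
    (hG : ∀ z ≠ 0, 2 * G p < G (p + z) + G (p - z))
    (hmin : IsLocalMinOn (fun q => M.vex Y q - G q) (simplex I) p) :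
    ∃ q : M.nodes, (q : E I) = p ∧ M.vex Y p = Y q := by
  obtain ⟨lam, hlam, e⟩ := exists_isRep_vex_eq Y hp
  have hsupp (q : M.nodes) (hq : 0 < lam q) : (q : E I) = p := by
    by_contra hqp
    -- shifting a little weight to or from `q` moves the point along the direction `q - p`
    have hpert (s : ℝ) (hs : -1 ≤ s) (hsq : s ≤ lam q) :
        M.IsRep (p - s • ((q : E I) - p)) ((1 + s) • lam - s • Pi.single q 1) := by
      refine ⟨⟨fun r => ?_, ?_⟩, ?_⟩
      · rcases eq_or_ne r q with rfl | hr
        · simp only [Pi.sub_apply, Pi.smul_apply, Pi.single_eq_same, smul_eq_mul, mul_one]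
          rcases le_total 0 s with h | h
          · nlinarith
          · nlinarith
        · simpa [hr] using mul_nonneg (by linarith) (hlam.1.1 r)
      · simp only [Pi.sub_apply, Pi.smul_apply, smul_eq_mul, Finset.sum_sub_distrib,
          ← Finset.mul_sum, hlam.1.2, (isRep_single q).1.2]
        ring
      · simp only [Pi.sub_apply, Pi.smul_apply, smul_eq_mul, sub_smul, mul_smul,
          Finset.sum_sub_distrib, ← Finset.smul_sum, hlam.2, (isRep_single q).2]
        module
    have hval (s : ℝ) (hs : -1 ≤ s) (hsq : s ≤ lam q) :
        M.vex Y (p - s • ((q : E I) - p)) ≤ (1 + s) * M.vex Y p - s * Y q := by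
      refine ((hpert s hs hsq).vex_le Y).trans (le_of_eq ?_)
      have h1 : ∑ r, Y r * (Pi.single q 1 : M.nodes → ℝ) r = Y q := by simp [Pi.single_apply]
      rw [e, ← h1, Finset.mul_sum, Finset.mul_sum, ← Finset.sum_sub_distrib]
      refine Finset.sum_congr rfl fun r _ => ?_
      simp only [Pi.sub_apply, Pi.smul_apply, smul_eq_mul]
      ring
    have hlim (c : ℝ) : ∀ᶠ s in 𝓝 (0 : ℝ), p + (c * s) • ((q : E I) - p) ∈ simplex I →
        M.vex Y p - G p ≤ M.vex Y (p + (c * s) • ((q : E I) - p)) -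
          G (p + (c * s) • ((q : E I) - p)) := by
      have hc : Tendsto (fun s : ℝ => p + (c * s) • ((q : E I) - p)) (𝓝 0) (𝓝 p) := by
        have : Continuous fun s : ℝ => p + (c * s) • ((q : E I) - p) := by fun_prop
        simpa using this.tendsto 0
      exact hc.eventually (eventually_nhdsWithin_iff.1 hmin)
    obtain ⟨s, ⟨hs1, hs2, hs3⟩, hs⟩ := ((((hlim 1).and ((hlim (-1)).and
      (Iio_mem_nhds (lt_min one_pos hq)))).filter_mono nhdsWithin_le_nhds).and
        (self_mem_nhdsWithin (s := Ioi (0 : ℝ)))).exists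
    have hs0 : 0 < s := hs
    have hs1' : s < 1 := lt_of_lt_of_le hs3 (min_le_left _ _)
    have hs2' : s < lam q := lt_of_lt_of_le hs3 (min_le_right _ _)
    have hv1 := hval s (by linarith) hs2'.le
    have hv2 := hval (-s) (by linarith) (by linarith)
    have hm1 := (hpert s (by linarith) hs2'.le).mem_simplex
    have hm2 := (hpert (-s) (by linarith) (by linarith)).mem_simplex
    simp only [one_mul, neg_mul, neg_smul, sub_neg_eq_add, ← sub_eq_add_neg] at hs1 hs2 hv2 hm2
    have := hG (s • ((q : E I) - p)) (smul_ne_zero hs0.ne' (sub_ne_zero.2 hqp))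
    linarith [hs1 hm2, hs2 hm1]
  obtain ⟨q, -, hq⟩ := Finset.exists_ne_zero_of_sum_ne_zero
    (show ∑ q, lam q ≠ 0 by rw [hlam.1.2]; exact one_ne_zero)
  have hq0 : 0 < lam q := lt_of_le_of_ne (hlam.1.1 q) (Ne.symm hq)
  refine ⟨q, hsupp q hq0, ?_⟩
  calc M.vex Y p = ∑ r, Y q * lam r := by
        rw [e]
        refine Finset.sum_congr rfl fun r _ => ?_
        rcases (hlam.1.1 r).eq_or_lt with h | h
        · rw [← h, mul_zero, mul_zero]
        · rw [Subtype.ext ((hsupp r h).trans (hsupp q hq0).symm)]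
    _ = Y q := by rw [← Finset.mul_sum, hlam.1.2, mul_one]

end Mesh

end Vex

/-! ### One step of the scheme -/

section Step

variable {d I : ℕ} {EU EV : Type*} {D : GameData d I EU EV}

lemma walkExp_inner_smul (η : E d) : walkExp (fun ξ : E d => (inner ℝ η ξ : ℝ) • ξ) = η := by
  ext k
  have h : walkExp (fun ξ : E d => (inner ℝ η ξ : ℝ) * ξ k) =
      (walkExp fun ξ : E d => (inner ℝ η ξ : ℝ) • ξ) k :=
    walkExp_map (EuclideanSpace.proj k : E d →L[ℝ] ℝ).toLinearMap
      (fun ξ : E d => (inner ℝ η ξ : ℝ) • ξ)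
  rw [← h]
  have (ξ : E d) : (inner ℝ η ξ : ℝ) * ξ k = ∑ l, η l • (ξ l * ξ k) := by
    rw [PiLp.inner_apply, Finset.sum_mul]
    exact Finset.sum_congr rfl fun l _ => by simp; ring
  simp_rw [this, walkExp_sum, walkExp_smul, walkExp_apply_mul_apply]
  simp

/-- The weights `σ^{-T} ξ` recover the gradient of a linear function of `σ ξ`. -/
lemma walkExp_inner_mul_smul_invT {A : Matrix (Fin d) (Fin d) ℝ} (hA : IsUnit A) (ζ : E d) :
    walkExp (fun ξ : E d => (inner ℝ ζ (A.toEuclideanLin ξ) : ℝ) •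
      (A.transpose)⁻¹.toEuclideanLin ξ) = ζ := by
  have hin (ξ : E d) : (inner ℝ ζ (A.toEuclideanLin ξ) : ℝ) =
      inner ℝ (A.transpose.toEuclideanLin ζ) ξ := by
    rw [real_inner_comm, real_inner_comm ξ]
    simp only [Matrix.toEuclideanLin, EuclideanSpace.inner_eq_star_dotProduct]
    simp [Matrix.dotProduct_mulVec, Matrix.mulVec_transpose]
  have h := walkExp_map ((A.transpose)⁻¹.toEuclideanLin)
    (fun ξ : E d => (inner ℝ (A.transpose.toEuclideanLin ζ) ξ : ℝ) • ξ)
  simp only [map_smul] at h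
  simp_rw [hin, h, walkExp_inner_smul]
  have hdet : IsUnit A.transpose.det := by
    rw [Matrix.det_transpose]; exact (Matrix.isUnit_iff_isUnit_det A).1 hA
  ext k
  simp [Matrix.toEuclideanLin, Matrix.mulVec_mulVec, Matrix.nonsing_inv_mul _ hdet]

/-- The second moments of `σ ξ` are the entries of `σσᵀ`. -/
lemma walkExp_bilin (A : Matrix (Fin d) (Fin d) ℝ) (β : E d →ₗ[ℝ] E d →ₗ[ℝ] ℝ) :
    walkExp (fun ξ : E d => β (A.toEuclideanLin ξ) (A.toEuclideanLin ξ)) =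
      (A * A.transpose * Matrix.of fun i j =>
        β (EuclideanSpace.single i 1) (EuclideanSpace.single j 1)).trace := by
  have hb (ξ : E d) : β (A.toEuclideanLin ξ) (A.toEuclideanLin ξ) =
      ∑ i, ∑ j, ∑ k, ∑ l, (A i k * A j l * β (EuclideanSpace.single i 1)
        (EuclideanSpace.single j 1)) • (ξ k * ξ l) := by
    conv_lhs => rw [eq_sum_smul_single (A.toEuclideanLin ξ)]
    simp only [map_sum, map_smul, LinearMap.sum_apply, LinearMap.smul_apply, smul_eq_mul,
      Finset.mul_sum]
    rw [Finset.sum_comm]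
    refine Finset.sum_congr rfl fun i _ => Finset.sum_congr rfl fun j _ => ?_
    have (i : Fin d) : (A.toEuclideanLin ξ) i = ∑ k, A i k * ξ k := rfl
    rw [← mul_assoc, mul_comm ((A.toEuclideanLin ξ) j), this, this, Finset.sum_mul_sum,
      Finset.sum_mul]
    refine Finset.sum_congr rfl fun k _ => ?_
    rw [Finset.sum_mul]
    exact Finset.sum_congr rfl fun l _ => by ring
  simp_rw [hb, walkExp_sum, walkExp_smul, walkExp_apply_mul_apply]
  simp only [Matrix.trace, Matrix.diag, Matrix.mul_apply, Matrix.transpose_apply, Matrix.of_apply,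
    smul_eq_mul, mul_ite, mul_one, mul_zero, Finset.sum_ite_eq, Finset.mem_univ, if_true]
  rw [Finset.sum_comm]
  refine Finset.sum_congr rfl fun i _ => Finset.sum_congr rfl fun j _ => ?_
  rw [Finset.sum_mul]
  exact Finset.sum_congr rfl fun k _ => by ring

lemma GameData.eulerStep_eq (N n : ℕ) (x ξ : E d) :
    D.eulerStep N n x ξ = x + √(D.τ N) • (D.σ (D.gridTime N n) x).toEuclideanLin ξ := rfl

lemma GameData.eulerWeight_eq (N n : ℕ) (x ξ : E d) :
    D.eulerWeight N n x ξ = √(D.τ N) • (D.σInvT (D.gridTime N n) x).toEuclideanLin ξ := rfl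

/-- The discrete gradient is exact on quadratic functions: the even terms are annihilated by the odd
weight `σ^{-T} ξ`. -/
lemma GameData.stepZ_of_quadratic {N n : ℕ} {x : E d} (hτ : 0 < D.τ N)
    (hσ : IsUnit (D.σ (D.gridTime N n) x)) {W : E d → ℝ} {α : ℝ} {ζ : E d}
    {β : E d →ₗ[ℝ] E d →ₗ[ℝ] ℝ}
    (hW : ∀ y, W (x + y) = α + inner ℝ ζ y + β y y) : D.stepZ N n W x = ζ := by
  set A := D.σ (D.gridTime N n) x with hA
  have e (ξ : E d) : W (D.eulerStep N n x ξ) • D.eulerWeight N n x ξ =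
      D.τ N • ((inner ℝ ζ (A.toEuclideanLin ξ) : ℝ) • (A.transpose)⁻¹.toEuclideanLin ξ) +
      (α + β (√(D.τ N) • A.toEuclideanLin ξ) (√(D.τ N) • A.toEuclideanLin ξ)) •
        D.eulerWeight N n x ξ := by
    rw [GameData.eulerStep_eq, hW, ← hA, add_right_comm, add_comm (_ + _), add_smul,
      GameData.eulerWeight_eq, inner_smul_right, smul_smul, smul_smul]
    congr 1
    rw [mul_right_comm, Real.mul_self_sqrt hτ.le]
    rw [mul_smul]
    rfl
  rw [GameData.stepZ]
  simp_rw [e]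
  rw [walkExp_add, walkExp_smul, walkExp_inner_mul_smul_invT hσ, walkExp_odd, add_zero, smul_smul,
    inv_mul_cancel₀ hτ.ne', one_smul]
  intro ξ
  simp [GameData.eulerWeight_eq]

/-- The scheme is exact on quadratic functions. -/
lemma GameData.stepY_of_quadratic {N n : ℕ} {x : E d} (hτ : 0 < D.τ N)
    (hσ : IsUnit (D.σ (D.gridTime N n) x)) {W : E d → ℝ} {α : ℝ} {ζ : E d}
    {β : E d →ₗ[ℝ] E d →ₗ[ℝ] ℝ}
    (hW : ∀ y, W (x + y) = α + inner ℝ ζ y + β y y) (p : E I) :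
    D.stepY N n W x p = α + D.τ N * (walkExp (fun ξ : E d =>
      β ((D.σ (D.gridTime N n) x).toEuclideanLin ξ) ((D.σ (D.gridTime N n) x).toEuclideanLin ξ)) +
        D.H (D.gridTime N n) x ζ p) := by
  rw [GameData.stepY, GameData.stepZ_of_quadratic hτ hσ hW]
  set A := D.σ (D.gridTime N n) x with hA
  have e (ξ : E d) : W (D.eulerStep N n x ξ) = α + (√(D.τ N) * inner ℝ ζ (A.toEuclideanLin ξ) +
      D.τ N • β (A.toEuclideanLin ξ) (A.toEuclideanLin ξ)) := by
    rw [GameData.eulerStep_eq, hW, ← hA]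
    simp only [map_smul, LinearMap.smul_apply, inner_smul_right, smul_eq_mul, ← mul_assoc,
      Real.mul_self_sqrt hτ.le]
    ring
  simp_rw [e]
  rw [walkExp_add, walkExp_const, walkExp_add, walkExp_smul, walkExp_odd (f := fun ξ : E d =>
    √(D.τ N) * inner ℝ ζ (A.toEuclideanLin ξ)) (by intro ξ; simp), smul_eq_mul]
  ring

/-- The scheme is monotone for small time steps: raising `W` by `δ ≥ 0` raises the expectation by
`𝔼[δ]` and lowers the Hamiltonian term by at most `B 𝔼[δ |σ^{-T} ξ √τ|] ≤ 𝔼[δ]`. -/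
lemma GameData.stepY_mono {B : ℝ} (hB0 : 0 ≤ B) {N n : ℕ} {x : E d}
    {p : E I} (hB : ∀ z z', D.H (D.gridTime N n) x z p ≤ D.H (D.gridTime N n) x z' p + B * ‖z - z'‖)
    (hτ : 0 < D.τ N) (hw : ∀ ε : Fin d → ℤˣ, B * ‖D.eulerWeight N n x (signVec ε)‖ ≤ 1)
    {W W' : E d → ℝ} (h : ∀ ε : Fin d → ℤˣ,
      W (D.eulerStep N n x (signVec ε)) ≤ W' (D.eulerStep N n x (signVec ε))) :
    D.stepY N n W x p ≤ D.stepY N n W' x p := by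
  set δ : E d → ℝ := fun ξ => W' (D.eulerStep N n x ξ) - W (D.eulerStep N n x ξ) with hδ
  have hZ : D.stepZ N n W' x - D.stepZ N n W x =
      (D.τ N)⁻¹ • walkExp (fun ξ => δ ξ • D.eulerWeight N n x ξ) := by
    rw [sub_eq_iff_eq_add, GameData.stepZ, GameData.stepZ, ← smul_add, ← walkExp_add]
    simp [hδ, sub_smul]
  have hnorm : D.τ N * (B * ‖D.stepZ N n W x - D.stepZ N n W' x‖) ≤ walkExp δ := by
    rw [norm_sub_rev, hZ, norm_smul, norm_inv, Real.norm_of_nonneg hτ.le,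
      show ∀ a : ℝ, D.τ N * (B * ((D.τ N)⁻¹ * a)) = B * a by intro a; field_simp]
    refine (mul_le_mul_of_nonneg_left (norm_walkExp_le _) hB0).trans ?_
    rw [← smul_eq_mul, ← walkExp_smul]
    refine walkExp_mono fun ε => ?_
    have hδ0 : 0 ≤ δ (signVec ε) := sub_nonneg.2 (h ε)
    rw [norm_smul, Real.norm_of_nonneg hδ0, smul_eq_mul]
    nlinarith [hw ε]
  have hsplit : walkExp (fun ξ => W' (D.eulerStep N n x ξ)) =
      walkExp (fun ξ => W (D.eulerStep N n x ξ)) + walkExp δ := by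
    rw [← walkExp_add]; simp [hδ]
  have := mul_le_mul_of_nonneg_left (hB (D.stepZ N n W x) (D.stepZ N n W' x)) hτ.le
  rw [GameData.stepY, GameData.stepY, hsplit]
  rw [mul_add] at this
  linarith

end Step

/-! ### Regularity of the numerical solutions -/

section Numerical

variable {d I : ℕ} {EU EV : Type*} {D : GameData d I EU EV}

lemma _root_.LowerSemicontinuousOn.mul_continuous_nonneg {X : Type*} [TopologicalSpace X]
    {f c : X → ℝ} {s : Set X} (hf : LowerSemicontinuousOn f s) (hc : Continuous c)
    (hc0 : ∀ x, 0 ≤ c x) : LowerSemicontinuousOn (fun x => f x * c x) s := by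
  intro a ha y hy
  have h : Tendsto (fun ε => (f a - ε) * c a) (𝓝[>] 0) (𝓝 (f a * c a)) := by
    have : Continuous fun ε => (f a - ε) * c a := by fun_prop
    simpa using (this.tendsto 0).mono_left nhdsWithin_le_nhds
  obtain ⟨ε, hε, hε0⟩ := ((h.eventually (lt_mem_nhds hy)).and self_mem_nhdsWithin).exists
  have h1 := (continuous_const.mul hc).continuousAt (x := a) |>.eventually (lt_mem_nhds hε)
  filter_upwards [hf a ha (f a - ε) (sub_lt_self _ hε0), mem_nhdsWithin_of_mem_nhds h1]
    with b hb hb'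
  exact hb'.trans_le (mul_le_mul_of_nonneg_right hb.le (hc0 b))

lemma GameData.gridTime_succ (N n : ℕ) : D.gridTime N (n + 1) = D.gridTime N n + D.τ N := by
  simp [GameData.gridTime, add_mul]

lemma GameData.Vh_terminal (N : ℕ) (M : Mesh I) (x : E d) {p : E I} (hp : p ∈ simplex I) :
    D.Vh N M N x p = D.terminal x p := by
  have h : D.nodal N M N x = fun q : M.nodes => ∑ i, (q : E I) i * D.g i x := by
    funext q
    simp [GameData.nodal, GameData.backward, GameData.terminal]
  rw [GameData.Vh, h, Mesh.vex_linear _ hp, GameData.terminal]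

/-- The backward recursion in terms of the time index `n`, not of the number `N - n` of steps. -/
lemma GameData.nodal_eq_vex {N n : ℕ} (hn : n < N) (M : Mesh I) (x : E d) (q : M.nodes) :
    D.nodal N M n x q =
      M.vex (fun q' => D.stepY N n (fun y => D.nodal N M (n + 1) y q') x q') q := by
  obtain ⟨j, hj⟩ : ∃ j, N - n = j + 1 := ⟨N - n - 1, by omega⟩
  have h1 : N - (j + 1) = n := by omega
  have h2 : N - (n + 1) = j := by omega
  simp only [GameData.nodal, hj, h2, GameData.backward, h1]

/-- Before the terminal time the numerical solution is the envelope of the one-step values. -/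
lemma GameData.Vh_eq_vex {N n : ℕ} (hn : n < N) (M : Mesh I) (x : E d) {p : E I}
    (hp : p ∈ simplex I) :
    D.Vh N M n x p =
      M.vex (fun q' => D.stepY N n (fun y => D.nodal N M (n + 1) y q') x q') p := by
  rw [GameData.Vh, funext (D.nodal_eq_vex hn M x), Mesh.vex_vex _ hp]

lemma GameData.Vh_node {N n : ℕ} (hn : n ≤ N) (M : Mesh I) (x : E d) (q : M.nodes) :
    D.Vh N M n x q = D.nodal N M n x q := by
  rcases hn.eq_or_lt with rfl | hn
  · rw [GameData.Vh_terminal _ _ _ (M.mem_simplex q)]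
    simp [GameData.nodal, GameData.backward]
  · rw [GameData.Vh_eq_vex hn M x (M.mem_simplex q), GameData.nodal_eq_vex hn]

lemma GameData.isCompact_box (x : E d) (r : ℝ) :
    IsCompact (Icc 0 D.T ×ˢ Metric.closedBall x r ×ˢ simplex I) :=
  isCompact_Icc.prod ((isCompact_closedBall x r).prod isCompact_simplex)

variable [NormedAddCommGroup EU] [NormedAddCommGroup EV]

lemma GameData.Admissible.τ_pos (hD : D.Admissible) {N : ℕ} (hN : 0 < N) : 0 < D.τ N :=
  div_pos hD.T_pos (Nat.cast_pos.2 hN)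

lemma GameData.Admissible.gridTime_mem (hD : D.Admissible) {N n : ℕ} (hN : 0 < N) (hn : n ≤ N) :
    D.gridTime N n ∈ Icc 0 D.T := by
  have hτ := hD.τ_pos hN
  have hT : (N : ℝ) * D.τ N = D.T := mul_div_cancel₀ _ (Nat.cast_ne_zero.2 hN.ne')
  refine ⟨by unfold GameData.gridTime; positivity, ?_⟩
  rw [← hT]
  exact mul_le_mul_of_nonneg_right (Nat.cast_le.2 hn) hτ.le

lemma GameData.Admissible.continuousOn_σ (hD : D.Admissible) :
    ContinuousOn (fun q : ℝ × E d => D.σ q.1 q.2) (Icc 0 D.T ×ˢ univ) := by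
  obtain ⟨L, hL⟩ := hD.σ_lip
  exact continuousOn_pi.2 fun k => continuousOn_pi.2 fun l => (hL k l).continuousOn

lemma GameData.Admissible.continuousOn_σInvT (hD : D.Admissible) :
    ContinuousOn (fun q : ℝ × E d => D.σInvT q.1 q.2) (Icc 0 D.T ×ˢ univ) := by
  obtain ⟨L, hL⟩ := hD.σInvT_lip
  exact continuousOn_pi.2 fun k => continuousOn_pi.2 fun l => (hL k l).continuousOn

lemma continuous_toEuclideanLin {X : Type*} [TopologicalSpace X]
    {A : X → Matrix (Fin d) (Fin d) ℝ} (hA : Continuous A) (ξ : E d) :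
    Continuous fun x => (A x).toEuclideanLin ξ :=
  (PiLp.continuous_toLp 2 _).comp (hA.matrix_mulVec continuous_const)

lemma GameData.Admissible.continuous_stepY (hD : D.Admissible) {N n : ℕ} (hN : 0 < N) (hn : n ≤ N)
    {W : E d → ℝ} (hW : Continuous W) (p : E I) : Continuous fun x => D.stepY N n W x p := by
  have ht := hD.gridTime_mem hN hn
  have hmk : Continuous fun x : E d => (D.gridTime N n, x) := by fun_prop
  have hσ : Continuous fun x => D.σ (D.gridTime N n) x :=
    hD.continuousOn_σ.comp_continuous hmk fun x => ⟨ht, mem_univ _⟩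
  have hσ' : Continuous fun x => D.σInvT (D.gridTime N n) x :=
    hD.continuousOn_σInvT.comp_continuous hmk fun x => ⟨ht, mem_univ _⟩
  have hstep (ξ : E d) : Continuous fun x => D.eulerStep N n x ξ :=
    continuous_id.add ((continuous_toEuclideanLin hσ ξ).const_smul (√(D.τ N)))
  have hweight (ξ : E d) : Continuous fun x => D.eulerWeight N n x ξ :=
    (continuous_toEuclideanLin hσ' ξ).const_smul (√(D.τ N))
  have hZ : Continuous fun x => D.stepZ N n W x :=
    (continuous_walkExp (f := fun x ξ => W (D.eulerStep N n x ξ) • D.eulerWeight N n x ξ)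
      fun ε => (hW.comp (hstep _)).smul (hweight _)).const_smul (D.τ N)⁻¹
  refine (continuous_walkExp (f := fun x ξ => W (D.eulerStep N n x ξ))
    fun ε => hW.comp (hstep _)).add (continuous_const.mul ?_)
  exact hD.continuousOn_H.comp_continuous
    (f := fun x => (D.gridTime N n, x, D.stepZ N n W x, p)) (by fun_prop)
    fun x => ⟨ht, mem_univ _⟩

lemma GameData.Admissible.continuous_backward (hD : D.Admissible) {N : ℕ} (hN : 0 < N) (M : Mesh I)
    (j : ℕ) : Continuous fun x => D.backward N M j x := by
  induction j with
  | zero =>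
    obtain ⟨L, hL⟩ := hD.g_lip
    refine continuous_pi fun q => ?_
    have hg (i : Fin I) : Continuous (D.g i) := (hL i).continuous
    simp only [GameData.backward, GameData.terminal]
    fun_prop
  | succ j ih =>
    refine continuous_pi fun q => Mesh.continuous_vex (continuous_pi fun q' => ?_) (M.mem_simplex q)
    exact hD.continuous_stepY hN (Nat.sub_le _ _) ((continuous_apply q').comp ih) q'

lemma GameData.Admissible.lowerSemicontinuousOn_Vh (hD : D.Admissible) {N : ℕ} (hN : 0 < N)
    (M : Mesh I) (n : ℕ) :
    LowerSemicontinuousOn (fun P : E d × E I => D.Vh N M n P.1 P.2) (univ ×ˢ simplex I) :=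
  Mesh.lowerSemicontinuousOn_vex (hD.continuous_backward hN M (N - n))

/-- The interpolation in time in terms of hat functions, whose coefficients, unlike those in the
definition, depend continuously on `t`. -/
lemma GameData.Admissible.Vτh_eq_sum_hat (hD : D.Admissible) {N : ℕ} (hN : 0 < N) (M : Mesh I)
    {t : ℝ} (ht : t ∈ Icc 0 D.T) (x : E d) (p : E I) :
    D.Vτh N M (t, x, p) =
      ∑ n ∈ Finset.range (N + 1), D.Vh N M n x p * max 0 (1 - |t / D.τ N - n|) := by
  have hτ := hD.τ_pos hN
  have hT : D.T = N * D.τ N := (mul_div_cancel₀ _ (Nat.cast_ne_zero.2 hN.ne')).symm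
  set s := t / D.τ N with hs
  have hs0 : 0 ≤ s := div_nonneg ht.1 hτ.le
  have hsN : s ≤ N := by rw [hs, div_le_iff₀ hτ, ← hT]; exact ht.2
  set m := min ⌊s⌋₊ (N - 1) with hm
  have hmN : m + 1 ≤ N := by omega
  have hms : (m : ℝ) ≤ s := le_trans (Nat.cast_le.2 (min_le_left _ _)) (Nat.floor_le hs0)
  have hsm : s ≤ m + 1 := by
    rcases le_total ⌊s⌋₊ (N - 1) with h | h
    · rw [hm, min_eq_left h]; exact (Nat.lt_floor_add_one s).le
    · rw [hm, min_eq_right h]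
      have : ((N - 1 : ℕ) : ℝ) + 1 = N := by exact_mod_cast Nat.sub_add_cancel hN
      rw [this]; exact hsN
  have hsub : ({m, m + 1} : Finset ℕ) ⊆ Finset.range (N + 1) := by
    intro n hn
    simp only [Finset.mem_insert, Finset.mem_singleton] at hn
    simp only [Finset.mem_range]
    omega
  rw [← Finset.sum_subset hsub, Finset.sum_pair (by omega)]
  · have h1 : (D.gridTime N (m + 1) - t) / D.τ N = max 0 (1 - |s - m|) := by
      rw [abs_of_nonneg (by linarith), max_eq_right (by linarith), GameData.gridTime, sub_div,
        mul_div_cancel_right₀ _ hτ.ne', ← hs]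
      push_cast; ring
    have h2 : (t - D.gridTime N m) / D.τ N = max 0 (1 - |s - (m + 1 : ℕ)|) := by
      rw [Nat.cast_add_one, abs_of_nonpos (by linarith), max_eq_right (by linarith),
        GameData.gridTime, sub_div, mul_div_cancel_right₀ _ hτ.ne', ← hs]
      ring
    rw [← h1, ← h2]
    rfl
  · intro n _ hn
    simp only [Finset.mem_insert, Finset.mem_singleton, not_or] at hn
    rw [max_eq_left, mul_zero]
    rcases lt_or_gt_of_ne hn.1 with h | h
    · have : (n : ℝ) + 1 ≤ m := by exact_mod_cast h
      linarith [le_abs_self (s - n)]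
    · have : (m : ℝ) + 2 ≤ n := by exact_mod_cast (show m + 2 ≤ n by omega)
      linarith [neg_abs_le (s - n)]

lemma GameData.Admissible.Vτh_gridTime (hD : D.Admissible) {N n : ℕ} (hN : 0 < N) (hn : n ≤ N)
    (M : Mesh I) (x : E d) (p : E I) :
    D.Vτh N M (D.gridTime N n, x, p) = D.Vh N M n x p := by
  rw [hD.Vτh_eq_sum_hat hN M (hD.gridTime_mem hN hn),
    Finset.sum_eq_single_of_mem n (Finset.mem_range.2 (by omega))]
  · simp [GameData.gridTime, (hD.τ_pos hN).ne']
  · intro m _ hmn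
    rw [GameData.gridTime, mul_div_cancel_right₀ _ (hD.τ_pos hN).ne', max_eq_left, mul_zero]
    have : (1 : ℝ) ≤ |(n : ℝ) - m| := by
      exact_mod_cast Int.one_le_abs (sub_ne_zero.2 (Nat.cast_injective.ne hmn.symm : (n : ℤ) ≠ m))
    linarith

lemma GameData.Admissible.continuousOn_Vτh_time (hD : D.Admissible) {N : ℕ} (hN : 0 < N)
    (M : Mesh I) (x : E d) (p : E I) :
    ContinuousOn (fun t => D.Vτh N M (t, x, p)) (Icc 0 D.T) := by
  have h : Continuous fun t : ℝ =>
      ∑ n ∈ Finset.range (N + 1), D.Vh N M n x p * max 0 (1 - |t / D.τ N - n|) := by fun_prop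
  exact h.continuousOn.congr fun t ht => hD.Vτh_eq_sum_hat hN M ht x p

lemma GameData.Admissible.lowerSemicontinuousOn_Vτh (hD : D.Admissible) {N : ℕ} (hN : 0 < N)
    (M : Mesh I) : LowerSemicontinuousOn (D.Vτh N M) D.domain := by
  have h : LowerSemicontinuousOn (fun P : ℝ × E d × E I => ∑ n ∈ Finset.range (N + 1),
      D.Vh N M n P.2.1 P.2.2 * max 0 (1 - |P.1 / D.τ N - n|)) D.domain := by
    refine lowerSemicontinuousOn_sum fun n _ =>
      LowerSemicontinuousOn.mul_continuous_nonneg ?_ (by fun_prop) fun P => le_max_left _ _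
    exact (hD.lowerSemicontinuousOn_Vh hN M n).comp continuous_snd.continuousOn fun P hP => hP.2
  intro P hP y hy
  rw [hD.Vτh_eq_sum_hat hN M hP.1] at hy
  filter_upwards [h P hP y hy, self_mem_nhdsWithin] with Q hQ hQd
  rwa [hD.Vτh_eq_sum_hat hN M hQd.1]

lemma GameData.IsAccumulationPoint.lowerSemicontinuousOn (hD : D.Admissible)
    {w : ℝ × E d × E I → ℝ} (hw : D.IsAccumulationPoint w) :
    LowerSemicontinuousOn w D.domain := by
  obtain ⟨N, M, hN, -, -, hlim⟩ := hw
  rintro ⟨t, x, p⟩ hP y hy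
  have hK := hlim _ (D.isCompact_box (I := I) x 1)
    (prod_mono_right (prod_mono_left (subset_univ _)))
  set ε := (w (t, x, p) - y) / 3 with hε
  have hε0 : 0 < ε := div_pos (sub_pos.2 hy) (by norm_num)
  obtain ⟨k, hk⟩ := (Metric.tendstoUniformlyOn_iff.1 hK ε hε0).exists
  have hP' := abs_lt.1 (hk (t, x, p) ⟨hP.1, Metric.mem_closedBall_self zero_le_one, hP.2.2⟩)
  have hlsc := hD.lowerSemicontinuousOn_Vτh (hN k) (M k) (t, x, p) hP (y + ε) (by linarith)
  have hball : ∀ᶠ Q : ℝ × E d × E I in 𝓝 (t, x, p), Q.2.1 ∈ Metric.closedBall x 1 :=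
    (continuous_fst.comp continuous_snd).continuousAt.eventually
      (Metric.closedBall_mem_nhds x zero_lt_one)
  filter_upwards [hlsc, self_mem_nhdsWithin, mem_nhdsWithin_of_mem_nhds hball] with Q hQ hQd hQb
  have := abs_lt.1 (hk Q ⟨hQd.1, hQb, hQd.2.2⟩)
  linarith

lemma GameData.Admissible.Vτh_terminal (hD : D.Admissible) {N : ℕ} (hN : 0 < N) (M : Mesh I)
    (x : E d) {p : E I} (hp : p ∈ simplex I) : D.Vτh N M (D.T, x, p) = D.terminal x p := by
  have hT : D.T = D.gridTime N N := (mul_div_cancel₀ _ (Nat.cast_ne_zero.2 hN.ne')).symm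
  rw [hT, hD.Vτh_gridTime hN le_rfl, GameData.Vh_terminal _ _ _ hp]

end Numerical

/-! ### Discrete contact points and consistency -/

section Contact

variable {d I : ℕ} {EU EV : Type*} {D : GameData d I EU EV}

lemma GameData.isClosed_domain : IsClosed (D.domain) :=
  isClosed_Icc.prod (isClosed_univ.prod isCompact_simplex.isClosed)

/-- The inclusion of the space variable. -/
noncomputable def spaceIncl (d I : ℕ) : E d →L[ℝ] ℝ × E d × E I :=
  (ContinuousLinearMap.inr ℝ ℝ (E d × E I)).comp (ContinuousLinearMap.inl ℝ (E d) (E I))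

@[simp] lemma spaceIncl_apply (y : E d) : spaceIncl d I y = (0, y, 0) := rfl

/-- The vector representing the linear form `y ↦ A (0, y, 0)`. -/
noncomputable def spaceGrad (A : ℝ × E d × E I →L[ℝ] ℝ) : E d :=
  (InnerProductSpace.toDual ℝ (E d)).symm (A.comp (spaceIncl d I))

lemma inner_spaceGrad (A : ℝ × E d × E I →L[ℝ] ℝ) (y : E d) :
    inner ℝ (spaceGrad A) y = A (0, y, 0) := by
  simp [spaceGrad]

lemma continuous_spaceGrad : Continuous (spaceGrad (d := d) (I := I)) := by
  unfold spaceGrad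
  fun_prop

variable [NormedAddCommGroup EU] [NormedAddCommGroup EV]

/-- If `w - Q` has a strict local minimum at `P₀`, then the differences of the numerical solutions
and `Q`, restricted to the grid times, have local minima that converge to `P₀`. -/
lemma GameData.Admissible.exists_discrete_contact (hD : D.Admissible) {w : ℝ × E d × E I → ℝ}
    {N : ℕ → ℕ} {M : ℕ → Mesh I} (hN : ∀ k, 0 < N k)
    (hτ : Tendsto (fun k => D.τ (N k)) atTop (𝓝 0))
    (hlim : ∀ K : Set (ℝ × E d × E I), IsCompact K → K ⊆ D.domain →
      TendstoUniformlyOn (fun k => D.Vτh (N k) (M k)) w atTop K)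
    {P₀ : ℝ × E d × E I} (hP₀ : P₀ ∈ D.domain) {Q : ℝ × E d × E I → ℝ} (hQ : Continuous Q)
    {ε : ℝ} (hε : 0 < ε)
    (hmin : ∀ᶠ P in 𝓝[D.domain] P₀, w P₀ - Q P₀ + ε * dist P P₀ ^ 2 ≤ w P - Q P) :
    ∃ r > 0, ∃ P : ℕ → ℝ × E d × E I, Tendsto P atTop (𝓝 P₀) ∧
      ∀ᶠ k in atTop, P k ∈ D.domain ∧ (∃ n ≤ N k, (P k).1 = D.gridTime (N k) n) ∧
        ∀ P' ∈ D.domain, dist P' P₀ ≤ r → (∃ n ≤ N k, P'.1 = D.gridTime (N k) n) →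
          D.Vτh (N k) (M k) (P k) - Q (P k) ≤ D.Vτh (N k) (M k) P' - Q P' := by
  obtain ⟨r, hr, hball⟩ :=
    (nhdsWithin_hasBasis Metric.nhds_basis_closedBall D.domain).eventually_iff.1 hmin
  refine ⟨r, hr, ?_⟩
  set K : Set (ℝ × E d × E I) := Metric.closedBall P₀ r ∩ D.domain with hK
  have hKc : IsCompact K := (isCompact_closedBall P₀ r).inter_right GameData.isClosed_domain
  have hKd : K ⊆ D.domain := inter_subset_right
  -- the part of `K` at the grid times; there the numerical solution minus `Q` has a minimum
  set G : ℕ → Set (ℝ × E d × E I) := fun k =>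
    K ∩ Prod.fst ⁻¹' ((fun n => D.gridTime (N k) n) '' (Set.Iic (N k))) with hG
  have hGc (k : ℕ) : IsCompact (G k) := hKc.inter_right
    ((((Set.finite_Iic (N k)).image _).isClosed).preimage continuous_fst)
  have hGK (k : ℕ) : G k ⊆ K := inter_subset_left
  have hex (k : ℕ) : ∃ P, (G k).Nonempty →
      P ∈ G k ∧ IsMinOn (fun P => D.Vτh (N k) (M k) P - Q P) (G k) P := by
    by_cases hne : (G k).Nonempty
    · have hlsc : LowerSemicontinuousOn (fun P => D.Vτh (N k) (M k) P - Q P) (G k) := by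
        simp only [sub_eq_add_neg]
        exact ((hD.lowerSemicontinuousOn_Vτh (hN k) (M k)).mono ((hGK k).trans hKd)).add
          hQ.neg.continuousOn.lowerSemicontinuousOn
      obtain ⟨P, hP, h⟩ := hlsc.exists_isMinOn hne (hGc k)
      exact ⟨P, fun _ => ⟨hP, h⟩⟩
    · exact ⟨P₀, fun h => absurd h hne⟩
  choose P hP using hex
  -- the grid points just before the time of `P₀` are competitors
  obtain ⟨t, x, p⟩ := P₀
  set s : ℕ → ℝ := fun k => D.gridTime (N k) ⌊t / D.τ (N k)⌋₊ with hs
  have hsle (k : ℕ) : s k ≤ t := by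
    have := Nat.floor_le (div_nonneg hP₀.1.1 (hD.τ_pos (hN k)).le)
    rwa [le_div_iff₀ (hD.τ_pos (hN k))] at this
  have hles (k : ℕ) : t - D.τ (N k) ≤ s k := by
    have := (Nat.lt_floor_add_one (t / D.τ (N k))).le
    rw [div_le_iff₀ (hD.τ_pos (hN k)), add_mul, one_mul] at this
    exact sub_le_iff_le_add.2 this
  have hst : Tendsto s atTop (𝓝 t) := by
    refine tendsto_of_tendsto_of_tendsto_of_le_of_le (g := fun k => t - D.τ (N k)) ?_
      tendsto_const_nhds hles hsle
    simpa using tendsto_const_nhds.sub hτ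
  have hfloor (k : ℕ) : ⌊t / D.τ (N k)⌋₊ ≤ N k := by
    refine Nat.floor_le_of_le ?_
    rw [div_le_iff₀ (hD.τ_pos (hN k)), GameData.τ,
      mul_div_cancel₀ _ (Nat.cast_ne_zero.2 (hN k).ne')]
    exact hP₀.1.2
  have hsI (k : ℕ) : s k ∈ Icc 0 D.T := hD.gridTime_mem (hN k) (hfloor k)
  have hsG : ∀ᶠ k in atTop, (s k, x, p) ∈ G k := by
    filter_upwards [hst.eventually (Metric.closedBall_mem_nhds t hr)] with k hk
    refine ⟨⟨?_, hsI k, hP₀.2⟩, ⌊t / D.τ (N k)⌋₊, hfloor k, rfl⟩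
    simpa [Prod.dist_eq, hr.le] using hk
  have hws : Tendsto (fun k => w (s k, x, p) - Q (s k, x, p)) atTop
      (𝓝 (w (t, x, p) - Q (t, x, p))) := by
    have hline : IsCompact (Icc 0 D.T ×ˢ {(x, p)}) := isCompact_Icc.prod isCompact_singleton
    have hsub : Icc 0 D.T ×ˢ {(x, p)} ⊆ D.domain := by
      rintro ⟨t', xp⟩ ⟨h1, rfl⟩
      exact ⟨h1, hP₀.2⟩
    have hcont : ContinuousOn (fun t' => w (t', x, p)) (Icc 0 D.T) := by
      refine TendstoUniformlyOn.continuousOn (F := fun k t' => D.Vτh (N k) (M k) (t', x, p))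
        (p := atTop) ?_ (Frequently.of_forall fun k => hD.continuousOn_Vτh_time (hN k) (M k) x p)
      intro u hu
      filter_upwards [hlim _ hline hsub u hu] with k hk t' ht'
      exact hk (t', x, p) ⟨ht', rfl⟩
    refine Tendsto.sub ((hcont t hP₀.1).tendsto.comp
      (tendsto_nhdsWithin_iff.2 ⟨hst, Eventually.of_forall hsI⟩)) ?_
    exact (hQ.tendsto _).comp (hst.prodMk_nhds tendsto_const_nhds)
  refine ⟨P, ?_, ?_⟩
  · rw [Metric.tendsto_nhds]
    intro δ hδ
    set e := ε * δ ^ 2 / 4 with he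
    have he0 : 0 < e := by positivity
    filter_upwards [hsG, Metric.tendstoUniformlyOn_iff.1 (hlim K hKc hKd) e he0,
      hws.eventually (gt_mem_nhds (lt_add_of_pos_right _ he0))] with k hk hunif hwk
    obtain ⟨hPG, hPmin⟩ := hP k ⟨_, hk⟩
    have h1 := abs_lt.1 (hunif _ (hGK k hk))
    have h2 := abs_lt.1 (hunif _ (hGK k hPG))
    have h3 : D.Vτh (N k) (M k) (P k) - Q (P k) ≤
      D.Vτh (N k) (M k) (s k, x, p) - Q (s k, x, p) := hPmin hk
    have h4 := hball (hGK k hPG)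
    have h5 : ε * dist (P k) (t, x, p) ^ 2 < ε * δ ^ 2 := by
      have : ε * δ ^ 2 = 4 * e := by rw [he]; ring
      linarith
    exact lt_of_pow_lt_pow_left₀ 2 hδ.le (lt_of_mul_lt_mul_left h5 hε.le)
  · filter_upwards [hsG] with k hk
    obtain ⟨hPG, hPmin⟩ := hP k ⟨_, hk⟩
    obtain ⟨n, hn, hn'⟩ := hPG.2
    refine ⟨hKd (hGK k hPG), ⟨n, hn, hn'.symm⟩, ?_⟩
    rintro P' hP' hdist ⟨m, hm, hm'⟩
    exact hPmin ⟨⟨hdist, hP'⟩, m, hm, hm'.symm⟩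

/-- At a discrete contact point with a quadratic function that is strictly convex in `p`, the
contact point is a node at which the obstacle is inactive, and monotonicity of the scheme gives
the discrete differential inequality. -/
lemma GameData.Admissible.discrete_inequality (hD : D.Admissible) {N : ℕ} (hN : 0 < N) {M : Mesh I}
    {C : ℝ} (hC0 : 0 ≤ C)
    (hC : ∀ t ∈ Icc 0 D.T, ∀ x z z' p, D.H t x z p ≤ D.H t x z' p + C * ‖z - z'‖)
    {P₀ : ℝ × E d × E I} {A : ℝ × E d × E I →L[ℝ] ℝ}
    {B : ℝ × E d × E I →L[ℝ] ℝ × E d × E I →L[ℝ] ℝ} (hB : ∀ v v', B v v' = B v' v)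
    (hBp : ∀ z ≠ 0, 0 < B (0, 0, z) (0, 0, z)) {r : ℝ} {n : ℕ} (hn : n < N) {x : E d} {p : E I}
    (hp : p ∈ simplex I) (hr : dist (D.gridTime N n, x, p) P₀ < r)
    (hr' : ∀ ε : Fin d → ℤˣ,
      dist (D.gridTime N (n + 1), D.eulerStep N n x (signVec ε), p) P₀ ≤ r)
    (hw : ∀ ε : Fin d → ℤˣ, C * ‖D.eulerWeight N n x (signVec ε)‖ ≤ 1)
    {Q : ℝ × E d × E I → ℝ} (hQ : ∀ P, Q P = A (P - P₀) + 1 / 2 * B (P - P₀) (P - P₀))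
    (hmin : ∀ P' ∈ D.domain, dist P' P₀ ≤ r → (∃ m ≤ N, P'.1 = D.gridTime N m) →
      D.Vτh N M (D.gridTime N n, x, p) - Q (D.gridTime N n, x, p) ≤ D.Vτh N M P' - Q P') :
    A (1, 0, 0) + B ((D.gridTime N n, x, p) - P₀) (1, 0, 0) +
      D.τ N / 2 * B (1, 0, 0) (1, 0, 0) +
      1 / 2 * walkExp (fun ξ : E d => B (0, (D.σ (D.gridTime N n) x).toEuclideanLin ξ, 0)
        (0, (D.σ (D.gridTime N n) x).toEuclideanLin ξ, 0)) +
      D.H (D.gridTime N n) x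
        (spaceGrad (A + B ((D.gridTime N n, x, p) - P₀ + D.τ N • (1, 0, 0)))) p ≤ 0 := by
  set t := D.gridTime N n with ht
  have htI : t ∈ Icc 0 D.T := hD.gridTime_mem hN hn.le
  have hτ := hD.τ_pos hN
  set v := (t, x, p) - P₀ with hv
  set u := v + D.τ N • ((1 : ℝ), (0 : E d), (0 : E I)) with hu
  have hVh : D.Vτh N M (t, x, p) = D.Vh N M n x p := hD.Vτh_gridTime hN hn.le M x p
  -- the contact point is a node, and the data are not lowered there
  obtain ⟨q, hqp, hq⟩ : ∃ q : M.nodes, (q : E I) = p ∧ D.Vh N M n x p =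
      D.stepY N n (fun y => D.nodal N M (n + 1) y q) x q := by
    rw [D.Vh_eq_vex hn M x hp]
    refine Mesh.eq_node_of_touching hp (G := fun q => Q (t, x, q)) (fun z hz => ?_) ?_
    · have h1 : (t, x, p + z) - P₀ = v + (0, 0, z) := by ext <;> simp [hv, sub_add_eq_add_sub]
      have h2 : (t, x, p - z) - P₀ = v - (0, 0, z) := by ext <;> simp [hv, sub_right_comm]
      have := hBp z hz
      simp only [hQ, h1, h2, ← hv, map_add, map_sub, _root_.add_apply,
        _root_.sub_apply]
      linarith
    · have hc : ContinuousAt (fun q : E I => dist (t, x, q) P₀) p := by fun_prop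
      filter_upwards [mem_nhdsWithin_of_mem_nhds (hc.eventually (gt_mem_nhds hr)),
        self_mem_nhdsWithin] with q hq hqs
      have := hmin (t, x, q) ⟨htI, mem_univ _, hqs⟩ hq.le ⟨n, hn.le, rfl⟩
      rw [hVh, hD.Vτh_gridTime hN hn.le, D.Vh_eq_vex hn M x hp, D.Vh_eq_vex hn M x hqs] at this
      exact this
  -- `Q + c` lies below the numerical solution one time step later, with contact at this one
  set c := D.Vh N M n x p - Q (t, x, p) with hc
  have hmono : D.stepY N n (fun y => Q (D.gridTime N (n + 1), y, p) + c) x p ≤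
      D.stepY N n (fun y => D.nodal N M (n + 1) y q) x p := by
    refine GameData.stepY_mono hC0 (fun z z' => hC t htI x z z' p) hτ hw fun ε => ?_
    have := hmin (D.gridTime N (n + 1), D.eulerStep N n x (signVec ε), p)
      ⟨hD.gridTime_mem hN hn, mem_univ _, hp⟩ (hr' ε) ⟨n + 1, hn, rfl⟩
    rw [hVh, hD.Vτh_gridTime hN hn, ← hqp, D.Vh_node hn, hqp] at this
    linarith
  set β : E d →ₗ[ℝ] E d →ₗ[ℝ] ℝ :=
    ((1 / 2 : ℝ) • B.bilinearComp (spaceIncl d I) (spaceIncl d I)).toLinearMap₁₂ with hβ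
  have hβ' (y y' : E d) : β y y' = (1 / 2 : ℝ) • B (0, y, 0) (0, y', 0) := rfl
  have hquad (y : E d) : Q (D.gridTime N (n + 1), x + y, p) + c =
      (A u + 1 / 2 * B u u + c) + inner ℝ (spaceGrad (A + B u)) y + β y y := by
    have h1 : (D.gridTime N (n + 1), x + y, p) - P₀ = u + (0, y, 0) := by
      rw [D.gridTime_succ]
      ext <;> simp [hu, hv, ht, sub_add_eq_add_sub]
    rw [hQ, h1, inner_spaceGrad]
    simp only [map_add, _root_.add_apply, hβ', hB (0, y, 0) u, smul_eq_mul]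
    ring
  rw [GameData.stepY_of_quadratic hτ (hD.σ_inv t htI x) hquad] at hmono
  rw [hqp] at hq
  rw [← hq] at hmono
  simp only [hβ', walkExp_smul] at hmono
  rw [smul_eq_mul] at hmono
  rw [hc, hQ, ← hv, ← ht] at hmono
  have h1 : A u = A v + D.τ N * A (1, 0, 0) := by
    rw [hu, map_add, map_smul, smul_eq_mul]
  have h2 : B u u = B v v + 2 * D.τ N * B v (1, 0, 0) + D.τ N ^ 2 * B (1, 0, 0) (1, 0, 0) := by
    simp only [hu, map_add, map_smul, _root_.add_apply,
      _root_.smul_apply, smul_eq_mul, hB (1, 0, 0) v]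
    ring
  rw [h1, h2] at hmono
  refine nonpos_of_mul_nonpos_right ?_ hτ
  linarith

end Contact

/-! ### The viscosity inequality for quadratic test functions -/

section Limit

variable {d I : ℕ} {EU EV : Type*} [NormedAddCommGroup EU] [NormedAddCommGroup EV]
  {D : GameData d I EU EV}

lemma GameData.Admissible.tendsto_σ (hD : D.Admissible) {s : ℕ → ℝ} {y : ℕ → E d} {t : ℝ} {x : E d}
    (hs : Tendsto s atTop (𝓝 t)) (hy : Tendsto y atTop (𝓝 x)) (ht : t ∈ Icc 0 D.T)
    (hsI : ∀ᶠ k in atTop, s k ∈ Icc 0 D.T) :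
    Tendsto (fun k => D.σ (s k) (y k)) atTop (𝓝 (D.σ t x)) := by
  have h : Tendsto (fun k => (s k, y k)) atTop (𝓝[Icc 0 D.T ×ˢ univ] (t, x)) :=
    tendsto_nhdsWithin_iff.2 ⟨hs.prodMk_nhds hy, hsI.mono fun k hk => ⟨hk, mem_univ _⟩⟩
  have hc : Tendsto (fun q : ℝ × E d => D.σ q.1 q.2) (𝓝[Icc 0 D.T ×ˢ univ] (t, x))
      (𝓝 (D.σ t x)) := hD.continuousOn_σ (t, x) ⟨ht, mem_univ _⟩
  simpa only [Function.comp_def] using hc.comp h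

lemma GameData.Admissible.tendsto_σInvT (hD : D.Admissible) {s : ℕ → ℝ} {y : ℕ → E d} {t : ℝ}
    {x : E d} (hs : Tendsto s atTop (𝓝 t)) (hy : Tendsto y atTop (𝓝 x)) (ht : t ∈ Icc 0 D.T)
    (hsI : ∀ᶠ k in atTop, s k ∈ Icc 0 D.T) :
    Tendsto (fun k => D.σInvT (s k) (y k)) atTop (𝓝 (D.σInvT t x)) := by
  have h : Tendsto (fun k => (s k, y k)) atTop (𝓝[Icc 0 D.T ×ˢ univ] (t, x)) :=
    tendsto_nhdsWithin_iff.2 ⟨hs.prodMk_nhds hy, hsI.mono fun k hk => ⟨hk, mem_univ _⟩⟩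
  have hc : Tendsto (fun q : ℝ × E d => D.σInvT q.1 q.2) (𝓝[Icc 0 D.T ×ˢ univ] (t, x))
      (𝓝 (D.σInvT t x)) := hD.continuousOn_σInvT (t, x) ⟨ht, mem_univ _⟩
  simpa only [Function.comp_def] using hc.comp h

lemma GameData.Admissible.tendsto_H (hD : D.Admissible) {s : ℕ → ℝ} {y z : ℕ → E d} {q : ℕ → E I}
    {t : ℝ} {x ζ : E d} {p : E I} (hs : Tendsto s atTop (𝓝 t)) (hy : Tendsto y atTop (𝓝 x))
    (hz : Tendsto z atTop (𝓝 ζ)) (hq : Tendsto q atTop (𝓝 p)) (ht : t ∈ Icc 0 D.T)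
    (hsI : ∀ᶠ k in atTop, s k ∈ Icc 0 D.T) :
    Tendsto (fun k => D.H (s k) (y k) (z k) (q k)) atTop (𝓝 (D.H t x ζ p)) := by
  have h : Tendsto (fun k => (s k, y k, z k, q k)) atTop
      (𝓝[Icc 0 D.T ×ˢ univ] (t, x, ζ, p)) :=
    tendsto_nhdsWithin_iff.2 ⟨hs.prodMk_nhds (hy.prodMk_nhds (hz.prodMk_nhds hq)),
      hsI.mono fun k hk => ⟨hk, mem_univ _⟩⟩
  have hc : Tendsto (fun q : ℝ × E d × E d × E I => D.H q.1 q.2.1 q.2.2.1 q.2.2.2)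
      (𝓝[Icc 0 D.T ×ˢ univ] (t, x, ζ, p)) (𝓝 (D.H t x ζ p)) :=
    hD.continuousOn_H (t, x, ζ, p) ⟨ht, mem_univ _⟩
  simpa only [Function.comp_def] using hc.comp h

/-- The viscosity inequality at a point where an accumulation point is touched from below, with a
strict minimum of the difference, by a quadratic function that is strictly convex in `p`. -/
lemma GameData.IsAccumulationPoint.quadratic_inequality (hD : D.Admissible)
    {w : ℝ × E d × E I → ℝ} (hw : D.IsAccumulationPoint w) {t : ℝ} {x : E d} {p : E I}
    (ht : t ∈ Ico 0 D.T) (hp : p ∈ simplex I) {A : ℝ × E d × E I →L[ℝ] ℝ}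
    {B : ℝ × E d × E I →L[ℝ] ℝ × E d × E I →L[ℝ] ℝ} (hB : ∀ v v', B v v' = B v' v)
    (hBp : ∀ z ≠ 0, 0 < B (0, 0, z) (0, 0, z)) {ε : ℝ} (hε : 0 < ε)
    (hmin : ∀ᶠ P in 𝓝[D.domain] (t, x, p), w (t, x, p) + A (P - (t, x, p)) +
      1 / 2 * B (P - (t, x, p)) (P - (t, x, p)) + ε * ‖P - (t, x, p)‖ ^ 2 ≤ w P) :
    A (1, 0, 0) + 1 / 2 * walkExp (fun ξ : E d => B (0, (D.σ t x).toEuclideanLin ξ, 0)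
      (0, (D.σ t x).toEuclideanLin ξ, 0)) + D.H t x (spaceGrad A) p ≤ 0 := by
  obtain ⟨N, M, hN, hτ, -, hlim⟩ := hw
  obtain ⟨C, hC0, hC⟩ := hD.exists_H_lipschitz
  set P₀ := (t, x, p) with hP₀
  set Q : ℝ × E d × E I → ℝ := fun P => A (P - P₀) + 1 / 2 * B (P - P₀) (P - P₀) with hQ
  have hQc : Continuous Q := by
    have : Continuous fun P => B (P - P₀) (P - P₀) :=
      (B.continuous.comp (continuous_id.sub continuous_const)).clm_apply
        (continuous_id.sub continuous_const)
    exact (A.continuous.comp (continuous_id.sub continuous_const)).add (continuous_const.mul this)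
  have htI : t ∈ Icc 0 D.T := Ico_subset_Icc_self ht
  have hmin' : ∀ᶠ P in 𝓝[D.domain] P₀, w P₀ - Q P₀ + ε * dist P P₀ ^ 2 ≤ w P - Q P := by
    filter_upwards [hmin] with P hP
    have hQ0 : Q P₀ = 0 := by simp [hQ]
    rw [hQ0, dist_eq_norm, sub_zero]
    simp only [hQ]
    linarith
  obtain ⟨r, hr, P, hP, hPc⟩ :=
    hD.exists_discrete_contact hN hτ hlim ⟨htI, mem_univ _, hp⟩ hQc hε hmin'
  -- everything converges along the discrete contact points
  set S : ℕ → Matrix (Fin d) (Fin d) ℝ := fun k => D.σ (P k).1 (P k).2.1 with hS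
  set R : ℕ → Matrix (Fin d) (Fin d) ℝ := fun k => D.σInvT (P k).1 (P k).2.1 with hR
  have hPx : Tendsto (fun k => (P k).2.1) atTop (𝓝 x) :=
    (continuous_fst.comp continuous_snd).continuousAt.tendsto.comp hP
  have hPt : Tendsto (fun k => (P k).1) atTop (𝓝 t) := continuous_fst.continuousAt.tendsto.comp hP
  have hPp : Tendsto (fun k => (P k).2.2) atTop (𝓝 p) :=
    (continuous_snd.comp continuous_snd).continuousAt.tendsto.comp hP
  have hPI : ∀ᶠ k in atTop, (P k).1 ∈ Icc 0 D.T := hPc.mono fun k hk => hk.1.1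
  have hSlim : Tendsto S atTop (𝓝 (D.σ t x)) := hD.tendsto_σ hPt hPx htI hPI
  have hRlim : Tendsto R atTop (𝓝 (D.σInvT t x)) := hD.tendsto_σInvT hPt hPx htI hPI
  have hlin (ξ : E d) : Continuous fun m : Matrix (Fin d) (Fin d) ℝ => m.toEuclideanLin ξ :=
    continuous_toEuclideanLin continuous_id ξ
  have hsqrt : Tendsto (fun k => √(D.τ (N k))) atTop (𝓝 0) := by
    have := (Real.continuous_sqrt.tendsto 0).comp hτ
    rwa [Real.sqrt_zero] at this
  have hstep (ε : Fin d → ℤˣ) : Tendsto (fun k => ((P k).1 + D.τ (N k),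
      (P k).2.1 + √(D.τ (N k)) • (S k).toEuclideanLin (signVec ε), (P k).2.2)) atTop (𝓝 P₀) := by
    have h1 := hPt.add hτ
    have h2 := hPx.add (hsqrt.smul (((hlin (signVec ε)).tendsto _).comp hSlim))
    simp only [add_zero, zero_smul] at h1 h2
    exact h1.prodMk_nhds (h2.prodMk_nhds hPp)
  have hweight (ε : Fin d → ℤˣ) : Tendsto (fun k => C * ‖√(D.τ (N k)) •
      (R k).toEuclideanLin (signVec ε)‖) atTop (𝓝 0) := by
    simpa using ((hsqrt.smul (((hlin (signVec ε)).tendsto _).comp hRlim)).norm).const_mul C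
  have hu : Tendsto (fun k => P k - P₀ + D.τ (N k) • ((1 : ℝ), (0 : E d), (0 : E I))) atTop
      (𝓝 0) := by
    simpa using (hP.sub_const P₀).add (hτ.smul_const ((1 : ℝ), (0 : E d), (0 : E I)))
  have hmain : Tendsto (fun k => A (1, 0, 0) + B (P k - P₀) (1, 0, 0) +
      D.τ (N k) / 2 * B (1, 0, 0) (1, 0, 0) +
      1 / 2 * walkExp (fun ξ : E d => B (0, (S k).toEuclideanLin ξ, 0)
        (0, (S k).toEuclideanLin ξ, 0)) +
      D.H (P k).1 (P k).2.1 (spaceGrad (A + B (P k - P₀ + D.τ (N k) • (1, 0, 0)))) (P k).2.2) atTop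
      (𝓝 (A (1, 0, 0) + B (P₀ - P₀) (1, 0, 0) + 0 / 2 * B (1, 0, 0) (1, 0, 0) +
      1 / 2 * walkExp (fun ξ : E d => B (0, (D.σ t x).toEuclideanLin ξ, 0)
        (0, (D.σ t x).toEuclideanLin ξ, 0)) +
      D.H t x (spaceGrad (A + B 0)) p)) := by
    refine (((tendsto_const_nhds.add ?_).add ?_).add (Tendsto.const_mul _ ?_)).add ?_
    · exact ((B.continuous.clm_apply continuous_const).tendsto (P₀ - P₀)).comp (hP.sub_const P₀)
    · exact (hτ.div_const 2).mul_const _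
    · refine Continuous.tendsto (f := fun m : Matrix (Fin d) (Fin d) ℝ => walkExp (fun ξ : E d =>
        B (0, m.toEuclideanLin ξ, 0) (0, m.toEuclideanLin ξ, 0))) ?_ _ |>.comp hSlim
      refine continuous_walkExp (f := fun (m : Matrix (Fin d) (Fin d) ℝ) (ξ : E d) =>
        B (0, m.toEuclideanLin ξ, 0) (0, m.toEuclideanLin ξ, 0)) fun ε => ?_
      have hc : Continuous fun m : Matrix (Fin d) (Fin d) ℝ =>
          ((0 : ℝ), m.toEuclideanLin (signVec ε), (0 : E I)) :=
        continuous_const.prodMk ((hlin _).prodMk continuous_const)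
      exact (B.continuous.comp hc).clm_apply hc
    · have hz : Tendsto (fun k => spaceGrad (A + B (P k - P₀ + D.τ (N k) • (1, 0, 0)))) atTop
          (𝓝 (spaceGrad (A + B 0))) :=
        ((continuous_spaceGrad.comp (continuous_const.add B.continuous)).tendsto 0).comp hu
      exact hD.tendsto_H hPt hPx hz hPp htI hPI
  simp only [sub_self, map_zero, zero_div, zero_mul, add_zero, _root_.zero_apply] at hmain
  refine le_of_tendsto hmain ?_
  have hT : ∀ᶠ k in atTop, (P k).1 < D.T := hPt.eventually (gt_mem_nhds ht.2)
  filter_upwards [hPc, hT, hP.eventually (Metric.ball_mem_nhds P₀ hr),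
    eventually_all.2 fun ε => (hstep ε).eventually (Metric.closedBall_mem_nhds P₀ hr),
    eventually_all.2 fun ε => (hweight ε).eventually (gt_mem_nhds one_pos)]
    with k hk hkT hkr hkstep hkw
  obtain ⟨hkd, ⟨n, hn, hkn⟩, hkmin⟩ := hk
  have hnN : n < N k := by
    refine hn.lt_of_ne fun h => hkT.ne ?_
    rw [hkn, h]
    exact mul_div_cancel₀ _ (Nat.cast_ne_zero.2 (hN k).ne')
  have hPk : P k = (D.gridTime (N k) n, (P k).2.1, (P k).2.2) := by rw [← hkn]
  have := hD.discrete_inequality (hN k) (M := M k) hC0 hC hB hBp (r := r) hnN hkd.2.2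
    (x := (P k).2.1) (P₀ := P₀) (Q := Q) (A := A) (hPk ▸ hkr) (fun ε => ?_) (fun ε => ?_)
    (fun _ => rfl) (hPk ▸ hkmin)
  · rw [← hPk, ← hkn] at this
    exact this
  · have := hkstep ε
    rw [hkn, ← D.gridTime_succ] at this
    simp only [hS] at this
    rw [hkn] at this
    exact this
  · have := (hkw ε).le
    simp only [hR] at this
    rw [hkn] at this
    exact this

end Limit

/-! ### Second-order expansion of the test function -/

section Taylor

/-- Taylor's formula of second order with Peano remainder. -/
lemma eventually_abs_sub_quadratic_le {F : Type*} [NormedAddCommGroup F] [NormedSpace ℝ F]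
    {f : F → ℝ} {a : F} {B : F →L[ℝ] F →L[ℝ] ℝ} (hf : ∀ᶠ P in 𝓝 a, DifferentiableAt ℝ f P)
    (hB : HasFDerivAt (fderiv ℝ f) B a) (hsymm : ∀ v v', B v v' = B v' v) {ε : ℝ} (hε : 0 < ε) :
    ∀ᶠ P in 𝓝 a,
      |f P - (f a + fderiv ℝ f a (P - a) + 1 / 2 * B (P - a) (P - a))| ≤ ε * ‖P - a‖ ^ 2 := by
  have hd := (hasFDerivAt_iff_isLittleO.1 hB).def hε
  obtain ⟨r, hr, hball⟩ := Metric.eventually_nhds_iff_ball.1 (hf.and hd)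
  filter_upwards [Metric.ball_mem_nhds a hr] with P hP
  set g : F → ℝ := fun P => f P - (f a + fderiv ℝ f a (P - a) + 1 / 2 * B (P - a) (P - a)) with hg
  have hsub : Metric.closedBall a ‖P - a‖ ⊆ Metric.ball a r :=
    Metric.closedBall_subset_ball (by rwa [← dist_eq_norm])
  have hgd : ∀ z ∈ Metric.closedBall a ‖P - a‖, HasFDerivWithinAt g
      (fderiv ℝ f z - fderiv ℝ f a - B (z - a)) (Metric.closedBall a ‖P - a‖) z := by
    intro z hz
    have hid : HasFDerivAt (fun z : F => z - a) (ContinuousLinearMap.id ℝ F) z :=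
      (hasFDerivAt_id z).sub_const a
    have h1 := (hball z (hsub hz)).1.hasFDerivAt
    have h2 := (fderiv ℝ f a).hasFDerivAt.comp z hid
    have h3 := ((B.hasFDerivAt.comp z hid).clm_apply hid).const_mul (1 / 2)
    refine (h1.sub ((h2.const_add (f a)).add h3)).hasFDerivWithinAt.congr_fderiv ?_
    ext v
    simp
    rw [hsymm v z, hsymm v a]
    ring
  have hbound : ∀ z ∈ Metric.closedBall a ‖P - a‖,
      ‖fderiv ℝ f z - fderiv ℝ f a - B (z - a)‖ ≤ ε * ‖P - a‖ := fun z hz =>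
    (hball z (hsub hz)).2.trans
      (mul_le_mul_of_nonneg_left (by rw [← dist_eq_norm]; exact hz) hε.le)
  have := (convex_closedBall a ‖P - a‖).norm_image_sub_le_of_norm_hasFDerivWithin_le hgd hbound
    (Metric.mem_closedBall_self (norm_nonneg _)) (y := P) (by simp [dist_eq_norm])
  have hga : g a = 0 := by simp [hg]
  rw [hga, sub_zero, Real.norm_eq_abs, mul_assoc, ← sq] at this
  exact this

/-- The Hessian of `f ∘ e` for an affine map `e` with linear part `ι`. -/
lemma hessian_comp {n : ℕ} {F : Type*} [NormedAddCommGroup F] [NormedSpace ℝ F] {f : F → ℝ}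
    {e : E n → F} {ι : E n →L[ℝ] F} (he : ∀ y, HasFDerivAt e ι y) {y : E n}
    {B : F →L[ℝ] F →L[ℝ] ℝ} (hf : ∀ᶠ P in 𝓝 (e y), DifferentiableAt ℝ f P)
    (hB : HasFDerivAt (fderiv ℝ f) B (e y)) :
    hessian (fun y => f (e y)) y = Matrix.of fun i j =>
      B (ι (EuclideanSpace.single i 1)) (ι (EuclideanSpace.single j 1)) := by
  have hev : ∀ᶠ z in 𝓝 y, fderiv ℝ (fun y => f (e y)) z = (fderiv ℝ f (e z)).comp ι := by
    filter_upwards [(he y).continuousAt.eventually hf] with z hz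
    exact (hz.hasFDerivAt.comp z (he z)).fderiv
  ext i j
  simp only [hessian, Matrix.of_apply]
  have h1 : (fun z => fderiv ℝ (fun y => f (e y)) z (EuclideanSpace.single j 1)) =ᶠ[𝓝 y]
      fun z => fderiv ℝ f (e z) (ι (EuclideanSpace.single j 1)) := by
    filter_upwards [hev] with z hz
    rw [hz]; rfl
  have h2 : HasFDerivAt (fun z => fderiv ℝ f (e z) (ι (EuclideanSpace.single j 1)))
      (((ContinuousLinearMap.apply ℝ ℝ (ι (EuclideanSpace.single j 1))).comp B).comp ι) y :=
    ((ContinuousLinearMap.apply ℝ ℝ (ι (EuclideanSpace.single j 1))).hasFDerivAt.comp (e y)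
      hB).comp y (he y)
  rw [h1.fderiv_eq, h2.fderiv]
  rfl

lemma dotProduct_mulVec_bilin {n : ℕ} (β : E n →ₗ[ℝ] E n →ₗ[ℝ] ℝ) (z : E n) :
    dotProduct ((Matrix.of fun i j => β (EuclideanSpace.single i 1)
      (EuclideanSpace.single j 1)).mulVec z.ofLp) z.ofLp = β z z := by
  conv_rhs => rw [eq_sum_smul_single z]
  simp only [map_sum, map_smul, LinearMap.sum_apply, LinearMap.smul_apply, smul_eq_mul,
    dotProduct, Matrix.mulVec, Matrix.of_apply, Finset.sum_mul, Finset.mul_sum]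
  rw [Finset.sum_comm]
  exact Finset.sum_congr rfl fun i _ => Finset.sum_congr rfl fun j _ => by ring

/-- A lower bound of `λ_min` bounds the form on the vectors `q - p` with `q` in the simplex, since
these lie in the tangent cone. -/
lemma le_bilin_of_lt_lambdaMin {I : ℕ} {p : E I} {β : E I →ₗ[ℝ] E I →ₗ[ℝ] ℝ} {c : ℝ}
    (hc : (c : EReal) < lambdaMin p (Matrix.of fun i j => β (EuclideanSpace.single i 1)
      (EuclideanSpace.single j 1))) {q : E I} (hq : q ∈ simplex I) :
    c * ‖q - p‖ ^ 2 ≤ β (q - p) (q - p) := by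
  rcases eq_or_ne (q - p) 0 with h | h
  · simp [h]
  · have hmem : q - p ∈ tangentCone p \ {0} :=
      ⟨subset_closure ⟨1, one_pos, q, hq, by simp⟩, h⟩
    have := hc.trans_le (iInf₂_le (q - p) hmem)
    rw [EReal.coe_lt_coe_iff, dotProduct_mulVec_bilin, lt_div_iff₀ (by positivity)] at this
    exact this.le

end Taylor

/-! ### The supersolution inequality for smooth test functions -/

section Supersolution

variable {d I : ℕ} {EU EV : Type*} {D : GameData d I EU EV}

/-- The inclusion of the variable `p`. -/
noncomputable def probIncl (d I : ℕ) : E I →L[ℝ] ℝ × E d × E I :=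
  (ContinuousLinearMap.inr ℝ ℝ (E d × E I)).comp (ContinuousLinearMap.inr ℝ (E d) (E I))

/-- The projection to the variable `p`. -/
noncomputable def probProj (d I : ℕ) : ℝ × E d × E I →L[ℝ] E I :=
  (ContinuousLinearMap.snd ℝ (E d) (E I)).comp (ContinuousLinearMap.snd ℝ ℝ (E d × E I))

/-- The inner product of `ℝⁿ` as a bilinear, rather than sesquilinear, continuous form. -/
noncomputable def innerBilin (n : ℕ) : E n →L[ℝ] E n →L[ℝ] ℝ := innerSL ℝ

/-- The Euclidean inner product of `ℝ × ℝᵈ × ℝ^I`, as a bilinear form. -/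
noncomputable def euclForm (d I : ℕ) :
    ℝ × E d × E I →L[ℝ] ℝ × E d × E I →L[ℝ] ℝ :=
  (ContinuousLinearMap.mul ℝ ℝ).bilinearComp (ContinuousLinearMap.fst ℝ ℝ (E d × E I))
      (ContinuousLinearMap.fst ℝ ℝ (E d × E I)) +
    (innerBilin d).bilinearComp
      ((ContinuousLinearMap.fst ℝ (E d) (E I)).comp (ContinuousLinearMap.snd ℝ ℝ (E d × E I)))
      ((ContinuousLinearMap.fst ℝ (E d) (E I)).comp (ContinuousLinearMap.snd ℝ ℝ (E d × E I))) +
    (innerBilin I).bilinearComp (probProj d I) (probProj d I)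

lemma euclForm_apply (v v' : ℝ × E d × E I) :
    euclForm d I v v' = v.1 * v'.1 + inner ℝ v.2.1 v'.2.1 + inner ℝ v.2.2 v'.2.2 := rfl

lemma sq_norm_le_euclForm (v : ℝ × E d × E I) : ‖v‖ ^ 2 ≤ euclForm d I v v := by
  rw [euclForm_apply, real_inner_self_eq_norm_sq, real_inner_self_eq_norm_sq, ← sq, ← sq_abs v.1,
    ← Real.norm_eq_abs]
  have h1 := sq_nonneg ‖v.1‖
  have h2 := sq_nonneg ‖v.2.1‖
  have h3 := sq_nonneg ‖v.2.2‖
  rw [Prod.norm_def, Prod.norm_def]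
  rcases max_choice ‖v.1‖ (max ‖v.2.1‖ ‖v.2.2‖) with h | h <;> rw [h]
  · linarith
  · rcases max_choice ‖v.2.1‖ ‖v.2.2‖ with h | h <;> rw [h] <;> linarith

/-- The differential expression in terms of the full first and second derivatives, the second-order
term being written as an expectation over the random walk step. -/
lemma GameData.hjb_eq {φ : ℝ × E d × E I → ℝ} {t : ℝ} {x : E d} {p : E I}
    {B : ℝ × E d × E I →L[ℝ] ℝ × E d × E I →L[ℝ] ℝ}
    (hφ : ∀ᶠ P in 𝓝 (t, x, p), DifferentiableAt ℝ φ P)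
    (hB : HasFDerivAt (fderiv ℝ φ) B (t, x, p)) :
    D.hjb φ t x p = fderiv ℝ φ (t, x, p) (1, 0, 0) +
      1 / 2 * walkExp (fun ξ : E d => B (0, (D.σ t x).toEuclideanLin ξ, 0)
        (0, (D.σ t x).toEuclideanLin ξ, 0)) +
      D.H t x (spaceGrad (fderiv ℝ φ (t, x, p))) p := by
  have hd := hφ.self_of_nhds.hasFDerivAt
  have hx (y : E d) : HasFDerivAt (fun y : E d => (t, y, p)) (spaceIncl d I) y :=
    ((hasFDerivAt_const t y).prodMk ((hasFDerivAt_id y).prodMk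
      (hasFDerivAt_const p y))).congr_fderiv (by ext <;> rfl)
  have ht : HasDerivAt (fun s => φ (s, x, p)) (fderiv ℝ φ (t, x, p) (1, 0, 0)) t :=
    hd.comp_hasDerivAt t ((hasDerivAt_id t).prodMk (hasDerivAt_const t (x, p)))
  have hg : gradient (fun y => φ (t, y, p)) x = spaceGrad (fderiv ℝ φ (t, x, p)) := by
    have : fderiv ℝ (fun y => φ (t, y, p)) x = (fderiv ℝ φ (t, x, p)).comp (spaceIncl d I) :=
      (hd.comp x (hx x)).fderiv
    rw [gradient, spaceGrad, this]
  rw [GameData.hjb, ht.deriv, hg, hessian_comp hx hφ hB]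
  have := walkExp_bilin (D.σ t x) (B.bilinearComp (spaceIncl d I) (spaceIncl d I)).toLinearMap₁₂
  simp only [ContinuousLinearMap.toLinearMap₁₂_apply_apply_apply,
    ContinuousLinearMap.bilinearComp_apply] at this
  rw [← this]
  rfl

variable [NormedAddCommGroup EU] [NormedAddCommGroup EV]

/-- The supersolution inequality, for test functions that are merely `C²` at the contact point. -/
lemma GameData.IsAccumulationPoint.min_hjb_lambdaMin_nonpos (hD : D.Admissible)
    {w : ℝ × E d × E I → ℝ} (hw : D.IsAccumulationPoint w) {φ : ℝ × E d × E I → ℝ} {t : ℝ}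
    {x : E d} {p : E I} (ht : t ∈ Ico 0 D.T) (hp : p ∈ simplex I)
    (hφ : ContDiffAt ℝ 2 φ (t, x, p))
    (hmin : IsLocalMinOn (fun P => w P - φ P) D.domain (t, x, p)) :
    min (D.hjb φ t x p : EReal) (lambdaMin p (hessian (fun q => φ (t, x, q)) p)) ≤ 0 := by
  by_contra hcon
  obtain ⟨hhjb, hlam⟩ := lt_min_iff.1 (not_le.1 hcon)
  rw [EReal.coe_pos] at hhjb
  set A := fderiv ℝ φ (t, x, p) with hA
  set B := fderiv ℝ (fderiv ℝ φ) (t, x, p) with hBdef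
  have hdiff : ∀ᶠ P in 𝓝 (t, x, p), DifferentiableAt ℝ φ P :=
    (hφ.eventually (by simp)).mono fun P hP => hP.differentiableAt two_ne_zero
  have hB : HasFDerivAt (fderiv ℝ φ) B (t, x, p) :=
    ((hφ.fderiv_right (m := 1) (by norm_num)).differentiableAt one_ne_zero).hasFDerivAt
  have hsymm : ∀ v v', B v v' = B v' v :=
    fun v v' => (hφ.isSymmSndFDerivAt (by simp)).eq v v'
  have hq (q : E I) : HasFDerivAt (fun q : E I => (t, x, q)) (probIncl d I) q :=
    ((hasFDerivAt_const t q).prodMk ((hasFDerivAt_const x q).prodMk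
      (hasFDerivAt_id q))).congr_fderiv (by ext <;> rfl)
  rw [hessian_comp hq hdiff hB] at hlam
  obtain ⟨c, hc0, hc⟩ := EReal.lt_iff_exists_real_btwn.1 hlam
  rw [EReal.coe_pos] at hc0
  have hBp (q : E I) (hq : q ∈ simplex I) :
      c * ‖q - p‖ ^ 2 ≤ B (0, 0, q - p) (0, 0, q - p) :=
    le_bilin_of_lt_lambdaMin
      (β := (B.bilinearComp (probIncl d I) (probIncl d I)).toLinearMap₁₂) hc hq
  set m := walkExp (fun ξ : E d => ‖(D.σ t x).toEuclideanLin ξ‖ ^ 2) with hm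
  have hm0 : 0 ≤ m := by
    rw [← walkExp_const (d := d) (0 : ℝ)]
    exact walkExp_mono fun ε => by positivity
  -- the quadratic perturbation making the contact strict: `η < c` preserves the convexity in `p`,
  -- and the bound by `m`, the trace of `σσᵀ`, the positivity of the differential expression
  set η := min (c / 2) (D.hjb φ t x p / (m + 1)) with hη
  have hη0 : 0 < η := lt_min (by positivity) (by positivity)
  have hηc : η < c := (min_le_left _ _).trans_lt (half_lt_self hc0)
  have hηm : η * (m + 1) ≤ D.hjb φ t x p := by
    rw [← le_div_iff₀ (by positivity)]; exact min_le_right _ _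
  -- the Hessian of the quadratic test function: the `pp`-block, of which only the positivity on
  -- the tangent cone is known, is replaced by a multiple of the identity
  set B' := B - B.bilinearComp ((probIncl d I).comp (probProj d I))
      ((probIncl d I).comp (probProj d I)) +
    c • (innerBilin I).bilinearComp (probProj d I) (probProj d I) - η • euclForm d I
    with hB'
  have hB'a (v v' : ℝ × E d × E I) : B' v v' = B v v' - B (0, 0, v.2.2) (0, 0, v'.2.2) +
      c * inner ℝ v.2.2 v'.2.2 - η * euclForm d I v v' := rfl
  have key := hw.quadratic_inequality hD (x := x) ht hp (A := A) (B := B') (ε := η / 4) ?_ ?_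
    (by positivity) ?_
  · have e (y : E d) : B' (0, y, 0) (0, y, 0) = B (0, y, 0) (0, y, 0) + (-η) * ‖y‖ ^ 2 := by
      have h0 : ((0 : ℝ), (0 : E d), (0 : E I)) = 0 := rfl
      rw [hB'a, euclForm_apply]
      simp only [h0, map_zero, inner_zero_left, real_inner_self_eq_norm_sq, mul_zero]
      ring
    have e' : walkExp (fun ξ : E d => B' (0, (D.σ t x).toEuclideanLin ξ, 0)
        (0, (D.σ t x).toEuclideanLin ξ, 0)) =
        walkExp (fun ξ : E d => B (0, (D.σ t x).toEuclideanLin ξ, 0)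
        (0, (D.σ t x).toEuclideanLin ξ, 0)) + (-η) * m := by
      simp only [e]
      rw [walkExp_add]
      congr 1
      exact walkExp_smul (-η) _
    rw [e'] at key
    have := D.hjb_eq hdiff hB
    rw [← hA] at this
    nlinarith
  · intro v v'
    simp only [hB'a, euclForm_apply]
    rw [hsymm v, hsymm (0, 0, v.2.2), real_inner_comm v.2.2, real_inner_comm v.2.1, mul_comm v.1]
  · intro z hz
    rw [hB'a, euclForm_apply]
    simp only [inner_zero_left, real_inner_self_eq_norm_sq, mul_zero]
    have : 0 < ‖z‖ ^ 2 := by positivity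
    nlinarith
  · filter_upwards [hmin, self_mem_nhdsWithin, mem_nhdsWithin_of_mem_nhds
      (eventually_abs_sub_quadratic_le hdiff hB hsymm (show 0 < η / 4 by positivity))]
      with P hP hPd hPt
    have h1 := (abs_le.1 hPt).1
    have h2 := sq_norm_le_euclForm (P - (t, x, p))
    have h3 := hBp P.2.2 hPd.2.2
    have h4 : B' (P - (t, x, p)) (P - (t, x, p)) = B (P - (t, x, p)) (P - (t, x, p)) -
        B (0, 0, P.2.2 - p) (0, 0, P.2.2 - p) + c * ‖P.2.2 - p‖ ^ 2 -
        η * euclForm d I (P - (t, x, p)) (P - (t, x, p)) := by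
      rw [hB'a, Prod.snd_sub, Prod.snd_sub, real_inner_self_eq_norm_sq]
    rw [h4]
    have h5 := mul_le_mul_of_nonneg_left h2 hη0.le
    linarith

end Supersolution

end AsymGame

theorem mainTheorem2 {d I : ℕ} {EU EV : Type*}
    [NormedAddCommGroup EU] [NormedSpace ℝ EU] [FiniteDimensional ℝ EU]
    [NormedAddCommGroup EV] [NormedSpace ℝ EV] [FiniteDimensional ℝ EV]
    (D : AsymGame.GameData d I EU EV) (hD : D.Admissible)
    (w : ℝ × AsymGame.E d × AsymGame.E I → ℝ) (hw : D.IsAccumulationPoint w) :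
    D.IsViscositySupersolution w := by
  refine ⟨hw.lowerSemicontinuousOn hD, fun x p hp => ?_, fun φ t x p ht hp hφ hmin => ?_⟩
  · obtain ⟨N, M, hN, -, -, hlim⟩ := hw
    have hmem : (D.T, x, p) ∈ D.domain := ⟨⟨hD.T_pos.le, le_rfl⟩, mem_univ _, hp⟩
    have := (hlim {(D.T, x, p)} isCompact_singleton (singleton_subset_iff.2 hmem)).tendsto_at
      (mem_singleton _)
    simp only [fun k => hD.Vτh_terminal (hN k) (M k) x hp] at this
    exact (tendsto_nhds_unique this tendsto_const_nhds).ge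
  · obtain ⟨O, hO, hφO⟩ := hφ
    exact hw.min_hjb_lambdaMin_nonpos hD ht hp
      ((hφO.contDiffAt hO).of_le (WithTop.coe_le_coe.2 (le_top : (2 : ℕ∞) ≤ ⊤))) hmin
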